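/- Let $R$ be a commutative ring with $1$ and let $(P,\preceq)$ be a finite poset with $n$ elements (for instance $P=\{1,\dots,n\}$ with any partial order). Let $\mathfrak{gl}_n^{\preceq}(R)$ be the Lie $R$-algebra, under the commutator bracket, of all $P\times P$ matrices $m$ over $R$ with $m_{ij}=0$ whenever $i\not\preceq j$; it has the $R$-basis of matrix units $\{e_{ij}:i\preceq j\}$. Let $H^*(\mathfrak g)=\bigoplus_k H^k(\mathfrak g)$ be the Chevalley cohomology of a Lie algebra $\mathfrak g$ with trivial coefficients $R$, i.e. the cohomology of the complex $\mathrm{Hom}_R(\Lambda^k\mathfrak g,R)$ with $$(df)(v_1\wedge\dots\wedge v_k)=\sum_{r<s}(-1)^{r+s}f([v_r,v_s]\wedge v_1\wedge\dots\widehat{v_r}\dots\widehat{v_s}\dots\wedge v_k),$$ which is a graded $R$-algebra under the cup product, given on cochains by the shuffle formula. (1) Suppose that $\mathbb Q\le R$ (as a subring), or that $\mathbb F_p\le R$ for a prime $p\ge n$. Then there is an isomorphism of graded $R$-algebras $$H^*(\mathfrak{gl}_n^{\preceq}(R))\cong\Lambda_R[x_i : i\in P]=\Lambda_R[x_1,\dots,x_n],$$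 where $x_i$ has degree $1$ and corresponds to the class of the $1$-cocycle $m\mapsto m_{ii}$, the element dual to $e_{ii}$. (2) Suppose that $\mathbb F_p\le R$ for the prime $p=n-1$. (2a) If $(P,\preceq)$ has a least element $a$ and a greatest element $b$, then there is an isomorphism of graded $R$-algebras $$H^*(\mathfrak{gl}_n^{\preceq}(R))\cong\Lambda_R[x_1,\dots,x_n,y],$$ where $x_i$ has degree $1$ and corresponds to the class of $m\mapsto m_{ii}$, and $y$ has degree $2p-1$ and corresponds to the class of the cocycle dual to the wedge $e_{ab}\wedge\bigwedge_{x\ne a,b}(e_{ax}\wedge e_{xb})$, that is, of the exterior product of the coordinate functionals dual to $e_{ab}$ and to the $e_{ax},e_{xb}$ with $x\neq a,b$. (2b) If $(P,\preceq)$ does not have both a least and a greatest element, then $H^*(\mathfrak{gl}_n^{\preceq}(R))\cong\Lambda_R[x_1,\dots,x_n]$ as graded $R$-algebras, with $x_i$ as in (1). -/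

import Mathlib

/-! ## Families of alternating forms

The degree `k` cochains of a Lie algebra `L` over `R` with trivial coefficients are the `R`-linear
maps `⋀^k L → R`, that is, the alternating `k`-linear forms on `L`. -/

namespace Chevalley

section Forms

variable {R L : Type*} [CommRing R] [LieRing L] [LieAlgebra R L]

variable (R L) in
/-- A family of alternating forms on `L`, one in every degree. -/
def Forms : Type _ := ∀ k : ℕ, L [⋀^Fin k]→ₗ[R] R

instance : AddCommGroup (Forms R L) :=
  inferInstanceAs (AddCommGroup (∀ k : ℕ, L [⋀^Fin k]→ₗ[R] R))

instance : Module R (Forms R L) :=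
  inferInstanceAs (Module R (∀ k : ℕ, L [⋀^Fin k]→ₗ[R] R))

namespace Forms

@[simp] theorem add_apply (f g : Forms R L) (k : ℕ) (v : Fin k → L) :
    (f + g) k v = f k v + g k v := rfl
@[simp] theorem neg_apply (f : Forms R L) (k : ℕ) (v : Fin k → L) : (-f) k v = -f k v := rfl
@[simp] theorem sub_apply (f g : Forms R L) (k : ℕ) (v : Fin k → L) :
    (f - g) k v = f k v - g k v := by
  rw [sub_eq_add_neg, sub_eq_add_neg, add_apply, neg_apply]
@[simp] theorem smul_apply (r : R) (f : Forms R L) (k : ℕ) (v : Fin k → L) :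
    (r • f) k v = r * f k v := rfl
@[simp] theorem zero_apply (k : ℕ) (v : Fin k → L) : (0 : Forms R L) k v = 0 := rfl

theorem ext_apply {f g : Forms R L} (h : ∀ k v, f k v = g k v) : f = g :=
  funext fun k => AlternatingMap.ext (h k)

/-- Every tuple of length `k + 1` is of the form `Fin.cons x v`. -/
theorem eq_of_cons {A B : Type*} {k : ℕ} {F G : (Fin (k + 1) → A) → B}
    (h : ∀ x v, F (Fin.cons x v) = G (Fin.cons x v)) (w : Fin (k + 1) → A) : F w = G w := by
  rw [← Fin.cons_self_tail w]
  exact h _ _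

/-- Contraction with `x`: insert `x` as the first argument. -/
def contr (x : L) (f : Forms R L) : Forms R L := fun k => (f (k + 1)).curryLeft x

theorem contr_apply (x : L) (f : Forms R L) (k : ℕ) (v : Fin k → L) :
    contr x f k v = f (k + 1) (Fin.cons x v) := rfl

/-- The degree involution, multiplication by `(-1)^k` in degree `k`. -/
def invol (f : Forms R L) : Forms R L := fun k => (-1 : R) ^ k • f k

@[simp] theorem invol_apply (f : Forms R L) (k : ℕ) (v : Fin k → L) :
    invol f k v = (-1 : R) ^ k * f k v := rfl

theorem contr_add (x : L) (f g : Forms R L) : contr x (f + g) = contr x f + contr x g := rfl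
theorem contr_smul (x : L) (r : R) (f : Forms R L) : contr x (r • f) = r • contr x f := rfl
theorem contr_neg (x : L) (f : Forms R L) : contr x (-f) = -contr x f := rfl
theorem contr_sub (x : L) (f g : Forms R L) : contr x (f - g) = contr x f - contr x g :=
  ext_apply fun k v => by simp [contr_apply]
theorem contr_add_left (x y : L) (f : Forms R L) : contr (x + y) f = contr x f + contr y f :=
  funext fun k => (f (k + 1)).curryLeft.map_add x y
theorem contr_smul_left (r : R) (x : L) (f : Forms R L) : contr (r • x) f = r • contr x f :=
  funext fun k => (f (k + 1)).curryLeft.map_smul r x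
theorem contr_self (x : L) (f : Forms R L) : contr x (contr x f) = 0 :=
  funext fun k => AlternatingMap.curryLeft_same (f (k + 2)) x
theorem contr_comm (x y : L) (f : Forms R L) : contr x (contr y f) = -contr y (contr x f) := by
  have h := contr_self (x + y) f
  simp only [contr_add_left, contr_add, contr_self, zero_add, add_zero] at h
  exact eq_neg_of_add_eq_zero_right h

theorem invol_add (f g : Forms R L) : invol (f + g) = invol f + invol g :=
  ext_apply fun k v => by simp [mul_add]
theorem invol_smul (r : R) (f : Forms R L) : invol (r • f) = r • invol f :=
  ext_apply fun k v => by simp [mul_left_comm]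
theorem invol_sub (f g : Forms R L) : invol (f - g) = invol f - invol g :=
  ext_apply fun k v => by simp [mul_sub]
theorem invol_neg (f : Forms R L) : invol (-f) = -invol f :=
  ext_apply fun k v => by simp
theorem invol_invol (f : Forms R L) : invol (invol f) = f :=
  ext_apply fun k v => by simp [← mul_assoc, ← mul_pow]
theorem contr_invol (x : L) (f : Forms R L) : contr x (invol f) = -invol (contr x f) :=
  ext_apply fun k v => by simp [contr_apply, pow_succ]

/-- A function that is linear in the first argument, alternating in the others, and vanishes when
the first two arguments agree, is an alternating form. -/
theorem exists_form {k : ℕ} (F : L → L [⋀^Fin k]→ₗ[R] R)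
    (hadd : ∀ x y v, F (x + y) v = F x v + F y v) (hsmul : ∀ (r : R) x v, F (r • x) v = r * F x v)
    (hself : ∀ x (v : Fin k → L) (j : Fin k), (j : ℕ) = 0 → v j = x → F x v = 0)
    (G : (Fin (k + 1) → L) → R) (hG : ∀ x v, G (Fin.cons x v) = F x v) :
    ∃ A : L [⋀^Fin (k + 1)]→ₗ[R] R, ∀ v, A v = G v := by
  let F' : L →ₗ[R] L [⋀^Fin k]→ₗ[R] R :=
    { toFun := F
      map_add' := fun x y => AlternatingMap.ext (hadd x y)
      map_smul' := fun r x => AlternatingMap.ext (hsmul r x) }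
  let M : MultilinearMap R (fun _ : Fin (k + 1) => L) R :=
    LinearMap.uncurryLeft (M := fun _ : Fin (k + 1) => L)
      ((AlternatingMap.toMultilinearMapLM (S := R)).comp F')
  have hM : ∀ v, M v = F (v 0) (Fin.tail v) := fun v => rfl
  have h0 : ∀ (v : Fin (k + 1) → L) (j : Fin k), v 0 = v j.succ → F (v 0) (Fin.tail v) = 0 := by
    intro v j hj
    have hk : 0 < k := lt_of_le_of_lt (Nat.zero_le _) j.isLt
    by_cases hj0 : j = ⟨0, hk⟩
    · exact hself _ _ j (by rw [hj0]) hj.symm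
    · have h1 := (F (v 0)).map_swap (Fin.tail v) hj0
      rw [← neg_eq_iff_eq_neg] at h1
      rw [← h1, hself _ _ ⟨0, hk⟩ rfl, neg_zero]
      simp only [Function.comp, Equiv.swap_apply_right]
      exact hj.symm
  refine ⟨{ M with
    map_eq_zero_of_eq' := ?_ }, ?_⟩
  · intro v i j hv hij
    change M v = 0
    rw [hM]
    rcases Fin.eq_zero_or_eq_succ i with rfl | ⟨i, rfl⟩
    · rcases Fin.eq_zero_or_eq_succ j with rfl | ⟨j, rfl⟩
      · exact absurd rfl hij
      · exact h0 v j hv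
    · rcases Fin.eq_zero_or_eq_succ j with rfl | ⟨j, rfl⟩
      · exact h0 v i hv.symm
      · exact (F (v 0)).map_eq_zero_of_eq _ hv fun h => hij (congrArg _ h)
  · exact eq_of_cons (F := fun v => M v) fun x v => by rw [hG]; rfl

/-! ### The cup product -/

/-- The number of inversions of the shuffle permutation that lists first the elements of `S` and
then those of its complement, both in increasing order. -/
def inversions {k : ℕ} (S : Finset (Fin k)) : ℕ :=
  (Finset.univ.filter fun q : Fin k × Fin k => q.1 ∈ S ∧ q.2 ∉ S ∧ q.2 < q.1).card

/-- `f` evaluated at the subtuple of `v` indexed by `S`, in increasing order. -/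
def evalOn (f : Forms R L) {k : ℕ} (S : Finset (Fin k)) (v : Fin k → L) : R :=
  f S.card fun a => v (S.orderEmbOfFin rfl a)

/-- The shuffle formula for the cup product. A permutation `π` of `{1, …, k}` with
`π₁ < … < πᵢ` and `πᵢ₊₁ < … < πₖ` is the same thing as the subset `S = {π₁, …, πᵢ}`. -/
def cupFun (f g : Forms R L) (k : ℕ) (v : Fin k → L) : R :=
  ∑ S : Finset (Fin k), (-1 : R) ^ inversions S * (evalOn f S v * evalOn g Sᶜ v)

theorem evalOn_eq (f : Forms R L) {k m : ℕ} (S : Finset (Fin k)) (v : Fin k → L)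
    (h : S.card = m) (e : Fin m → Fin k) (he : StrictMono e) (hS : ∀ a, e a ∈ S) :
    evalOn f S v = f m fun a => v (e a) := by
  subst h
  rw [evalOn, Finset.orderEmbOfFin_unique rfl hS he]

/-- The subset of `Fin (k + 1)` obtained from `T ⊆ Fin k` by a shift. -/
abbrev shift {k : ℕ} (T : Finset (Fin k)) : Finset (Fin (k + 1)) := T.map (Fin.succEmb k)

theorem zero_notMem_shift {k : ℕ} (T : Finset (Fin k)) : (0 : Fin (k + 1)) ∉ shift T := by
  simp [shift]

theorem succ_mem_shift {k : ℕ} (T : Finset (Fin k)) (a : Fin k) :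
    a.succ ∈ shift T ↔ a ∈ T := by
  simp [shift]

theorem evalOn_shift (f : Forms R L) {k : ℕ} (T : Finset (Fin k)) (x : L) (v : Fin k → L) :
    evalOn f (shift T) (Fin.cons x v : Fin (k + 1) → L) = evalOn f T v := by
  rw [evalOn_eq f (shift T) _ (Finset.card_map _) (fun a => (T.orderEmbOfFin rfl a).succ)]
  · simp [evalOn]
  · exact fun a b h => by simpa using h
  · exact fun a => (succ_mem_shift _ _).2 (Finset.orderEmbOfFin_mem _ _ _)

theorem evalOn_insert (f : Forms R L) {k : ℕ} (T : Finset (Fin k)) (x : L) (v : Fin k → L) :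
    evalOn f (insert 0 (shift T)) (Fin.cons x v : Fin (k + 1) → L) = evalOn (contr x f) T v := by
  rw [evalOn_eq f (insert 0 (shift T)) _
    (by rw [Finset.card_insert_of_notMem (zero_notMem_shift T), Finset.card_map])
    (Fin.cons 0 fun a => (T.orderEmbOfFin rfl a).succ)]
  · rw [evalOn, contr_apply]
    congr 1
    ext a
    refine Fin.cases ?_ (fun a => ?_) a <;> simp
  · rw [Fin.strictMono_iff_lt_succ]
    intro i
    have hmono : StrictMono fun a => (T.orderEmbOfFin rfl a).succ := fun a b h => by simpa using h
    by_cases hi : (i : ℕ) = 0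
    · have : i.castSucc = 0 := Fin.ext hi
      rw [this]
      simp
    · obtain ⟨j, hj⟩ : ∃ j : Fin T.card, i.castSucc = j.succ :=
        (Fin.eq_zero_or_eq_succ i.castSucc).resolve_left fun h => hi (congrArg Fin.val h)
      rw [hj, Fin.cons_succ, Fin.cons_succ]
      refine hmono ?_
      have := congrArg Fin.val hj
      simp at this
      rw [Fin.lt_def]; omega
  · intro a
    refine Fin.cases ?_ (fun a => ?_) a
    · simp
    · rw [Fin.cons_succ]
      exact Finset.mem_insert_of_mem ((succ_mem_shift _ _).2 (Finset.orderEmbOfFin_mem _ _ _))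

theorem compl_shift {k : ℕ} (T : Finset (Fin k)) : (shift T)ᶜ = insert 0 (shift Tᶜ) := by
  ext a
  refine Fin.cases ?_ (fun a => ?_) a
  · simp
  · rw [Finset.mem_compl, succ_mem_shift, Finset.mem_insert, succ_mem_shift, Finset.mem_compl]
    simp [Fin.succ_ne_zero]

theorem compl_insert_shift {k : ℕ} (T : Finset (Fin k)) :
    (insert 0 (shift T))ᶜ = shift Tᶜ := by
  rw [compl_eq_comm, compl_shift, compl_compl]

theorem inversions_insert {k : ℕ} (T : Finset (Fin k)) :
    inversions (insert 0 (shift T)) = inversions T := by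
  unfold inversions
  simp only [Finset.card_filter, ← Finset.univ_product_univ, Finset.sum_product,
    Fin.sum_univ_succ]
  simp [Fin.succ_ne_zero]

theorem inversions_shift {k : ℕ} (T : Finset (Fin k)) :
    inversions (shift T) = T.card + inversions T := by
  unfold inversions
  simp only [Finset.card_filter, ← Finset.univ_product_univ, Finset.sum_product,
    Fin.sum_univ_succ]
  simp [Finset.sum_add_distrib]

theorem sum_finset_succ {k : ℕ} (F : Finset (Fin (k + 1)) → R) :
    ∑ S, F S = ∑ T : Finset (Fin k), F (insert 0 (shift T)) + ∑ T : Finset (Fin k), F (shift T) := by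
  have h : (Finset.univ : Finset (Finset (Fin (k + 1)))) =
      Finset.powerset (insert 0 (shift Finset.univ)) := by
    rw [← Finset.powerset_univ]
    congr 1
    ext a
    refine Fin.cases ?_ (fun a => ?_) a <;> simp
  have h2 : ∀ F : Finset (Fin (k + 1)) → R,
      ∑ S ∈ (shift (Finset.univ : Finset (Fin k))).powerset, F S = ∑ T, F (shift T) := by
    intro F
    symm
    refine Finset.sum_bij (fun T _ => shift T) ?_ ?_ ?_ ?_
    · intro T _
      exact Finset.mem_powerset.2 (Finset.map_subset_map.2 (Finset.subset_univ _))
    · intro a _ b _ hab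
      exact Finset.map_injective _ hab
    · intro S hS
      obtain ⟨u, -, hu⟩ := Finset.subset_map_iff.1 (Finset.mem_powerset.1 hS)
      exact ⟨u, Finset.mem_univ _, hu.symm⟩
    · intros; rfl
  rw [h, Finset.sum_powerset_insert (zero_notMem_shift _), h2, h2, add_comm]

theorem cupFun_cons (f g : Forms R L) (k : ℕ) (x : L) (v : Fin k → L) :
    cupFun f g (k + 1) (Fin.cons x v) =
      cupFun (contr x f) g k v + cupFun (invol f) (contr x g) k v := by
  unfold cupFun
  rw [sum_finset_succ]
  congr 1
  · refine Finset.sum_congr rfl fun T _ => ?_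
    rw [compl_insert_shift, evalOn_insert, evalOn_shift, inversions_insert]
  · refine Finset.sum_congr rfl fun T _ => ?_
    rw [compl_shift, evalOn_insert, evalOn_shift, inversions_shift]
    simp only [evalOn, invol_apply, pow_add]
    ring

theorem evalOn_add (f g : Forms R L) {k : ℕ} (S : Finset (Fin k)) (v : Fin k → L) :
    evalOn (f + g) S v = evalOn f S v + evalOn g S v := rfl
theorem evalOn_smul (r : R) (f : Forms R L) {k : ℕ} (S : Finset (Fin k)) (v : Fin k → L) :
    evalOn (r • f) S v = r * evalOn f S v := rfl

theorem cupFun_add_left (f f' g : Forms R L) (k : ℕ) (v : Fin k → L) :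
    cupFun (f + f') g k v = cupFun f g k v + cupFun f' g k v := by
  simp only [cupFun, ← Finset.sum_add_distrib, evalOn_add]
  exact Finset.sum_congr rfl fun _ _ => by ring
theorem cupFun_add_right (f g g' : Forms R L) (k : ℕ) (v : Fin k → L) :
    cupFun f (g + g') k v = cupFun f g k v + cupFun f g' k v := by
  simp only [cupFun, ← Finset.sum_add_distrib, evalOn_add]
  exact Finset.sum_congr rfl fun _ _ => by ring
theorem cupFun_smul_left (r : R) (f g : Forms R L) (k : ℕ) (v : Fin k → L) :
    cupFun (r • f) g k v = r * cupFun f g k v := by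
  simp only [cupFun, Finset.mul_sum, evalOn_smul]
  exact Finset.sum_congr rfl fun _ _ => by ring
theorem cupFun_smul_right (r : R) (f g : Forms R L) (k : ℕ) (v : Fin k → L) :
    cupFun f (r • g) k v = r * cupFun f g k v := by
  simp only [cupFun, Finset.mul_sum, evalOn_smul]
  exact Finset.sum_congr rfl fun _ _ => by ring
theorem cupFun_zero_left (g : Forms R L) (k : ℕ) (v : Fin k → L) : cupFun 0 g k v = 0 := by
  simpa using cupFun_smul_left 0 0 g k v
theorem cupFun_zero_right (f : Forms R L) (k : ℕ) (v : Fin k → L) : cupFun f 0 k v = 0 := by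
  simpa using cupFun_smul_right 0 f 0 k v
theorem cupFun_neg_left (f g : Forms R L) (k : ℕ) (v : Fin k → L) :
    cupFun (-f) g k v = -cupFun f g k v := by
  simpa using cupFun_smul_left (-1) f g k v

theorem cupFun_zero_apply (f g : Forms R L) (v : Fin 0 → L) :
    cupFun f g 0 v = f 0 v * g 0 v := by
  have h1 : ∀ (f : Forms R L) (S : Finset (Fin 0)), evalOn f S v = f 0 v := fun f S => by
    rw [evalOn_eq f S v (by rw [Finset.eq_empty_of_isEmpty S]; rfl) (fun a => a.elim0)
      (fun a => a.elim0) (fun a => a.elim0)]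
    congr 1
    exact Subsingleton.elim _ _
  unfold cupFun
  simp [h1, inversions]

theorem exists_cup (k : ℕ) : ∀ f g : Forms R L,
    ∃ A : L [⋀^Fin k]→ₗ[R] R, ∀ v, A v = cupFun f g k v := by
  induction k with
  | zero =>
    intro f g
    refine ⟨AlternatingMap.constOfIsEmpty R L (Fin 0) (f 0 0 * g 0 0), fun v => ?_⟩
    rw [cupFun_zero_apply, Subsingleton.elim v 0]
    rfl
  | succ k ih =>
    intro f g
    choose A hA using ih
    refine exists_form (fun x => A (contr x f) g + A (invol f) (contr x g)) ?_ ?_ ?_ _ ?_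
    · intro x y v
      simp only [AlternatingMap.add_apply, hA, contr_add_left, cupFun_add_left, cupFun_add_right]
      ring
    · intro r x v
      simp only [AlternatingMap.add_apply, hA, contr_smul_left, cupFun_smul_left,
        cupFun_smul_right]
      ring
    · intro x v j hj hv
      cases k with
      | zero => exact j.elim0
      | succ k =>
        have hj0 : j = 0 := Fin.ext hj
        subst hj0
        have hvx : v = Fin.cons x (Fin.tail v) := by rw [← hv, Fin.cons_self_tail]
        rw [hvx]
        simp only [AlternatingMap.add_apply, hA, cupFun_cons, contr_self, contr_invol,
          cupFun_zero_left, cupFun_zero_right, cupFun_neg_left]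
        ring
    · intro x v
      rw [cupFun_cons, AlternatingMap.add_apply, hA, hA]

/-- The cup product of families of forms, by the shuffle formula. -/
instance : Mul (Forms R L) where
  mul f g := fun k =>
    { toFun := cupFun f g k
      map_update_add' := by
        obtain ⟨A, hA⟩ := exists_cup k f g
        intro _ m i x y
        rw [← hA, ← hA, ← hA]
        convert A.map_update_add m i x y
      map_update_smul' := by
        obtain ⟨A, hA⟩ := exists_cup k f g
        intro _ m i r x
        rw [← hA, ← hA]
        convert A.map_update_smul m i r x
      map_eq_zero_of_eq' := by
        obtain ⟨A, hA⟩ := exists_cup k f g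
        intro v i j hv hij
        rw [← hA]
        exact A.map_eq_zero_of_eq v hv hij }

theorem mul_apply (f g : Forms R L) (k : ℕ) (v : Fin k → L) :
    (f * g) k v = ∑ S : Finset (Fin k), (-1 : R) ^ inversions S * (evalOn f S v * evalOn g Sᶜ v) :=
  rfl

/-- The unit: the constant `1` in degree zero. -/
instance : One (Forms R L) where
  one := Pi.single 0 (AlternatingMap.constOfIsEmpty R L (Fin 0) 1)

theorem one_zero_apply (v : Fin 0 → L) : (1 : Forms R L) 0 v = 1 := rfl
theorem contr_one (x : L) : contr x (1 : Forms R L) = 0 := rfl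

theorem mul_zero_apply (f g : Forms R L) (v : Fin 0 → L) : (f * g) 0 v = f 0 v * g 0 v :=
  cupFun_zero_apply f g v

theorem contr_mul (x : L) (f g : Forms R L) :
    contr x (f * g) = contr x f * g + invol f * contr x g :=
  ext_apply fun k v => cupFun_cons f g k x v

/-- Two families that satisfy an inductive scheme under contraction agree. -/
theorem apply_succ_eq {k : ℕ} {f g : Forms R L}
    (h : ∀ x v, contr x f k v = contr x g k v) (w : Fin (k + 1) → L) :
    f (k + 1) w = g (k + 1) w :=
  eq_of_cons h w

theorem mul_add' (f g h : Forms R L) : f * (g + h) = f * g + f * h :=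
  ext_apply fun k v => cupFun_add_right f g h k v
theorem add_mul' (f g h : Forms R L) : (f + g) * h = f * h + g * h :=
  ext_apply fun k v => cupFun_add_left f g h k v
theorem smul_mul' (r : R) (f g : Forms R L) : (r • f) * g = r • (f * g) :=
  ext_apply fun k v => cupFun_smul_left r f g k v
theorem mul_smul' (r : R) (f g : Forms R L) : f * (r • g) = r • (f * g) :=
  ext_apply fun k v => cupFun_smul_right r f g k v
theorem zero_mul' (f : Forms R L) : 0 * f = 0 :=
  ext_apply fun k v => cupFun_zero_left f k v
theorem mul_zero' (f : Forms R L) : f * 0 = 0 :=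
  ext_apply fun k v => cupFun_zero_right f k v
theorem invol_one : invol (1 : Forms R L) = 1 := by
  refine ext_apply fun k v => ?_
  cases k with
  | zero => simp
  | succ k => change _ * (0 : R) = 0; simp

theorem one_mul' (f : Forms R L) : 1 * f = f := by
  have h : ∀ (k : ℕ) (f : Forms R L) (v : Fin k → L), (1 * f) k v = f k v := by
    intro k
    induction k with
    | zero => intro f v; rw [mul_zero_apply, one_zero_apply, one_mul]
    | succ k ih =>
      intro f v
      refine apply_succ_eq (fun x v => ?_) v
      rw [contr_mul, contr_one, zero_mul', zero_add, invol_one, ih]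
  exact ext_apply fun k v => h k f v

theorem mul_one' (f : Forms R L) : f * 1 = f := by
  have h : ∀ (k : ℕ) (f : Forms R L) (v : Fin k → L), (f * 1) k v = f k v := by
    intro k
    induction k with
    | zero => intro f v; rw [mul_zero_apply, one_zero_apply, mul_one]
    | succ k ih =>
      intro f v
      refine apply_succ_eq (fun x v => ?_) v
      rw [contr_mul, contr_one, mul_zero', add_zero, ih]
  exact ext_apply fun k v => h k f v

theorem neg_mul' (f g : Forms R L) : (-f) * g = -(f * g) :=
  ext_apply fun k v => cupFun_neg_left f g k v

theorem invol_mul (f g : Forms R L) : invol (f * g) = invol f * invol g := by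
  have h : ∀ (k : ℕ) (f g : Forms R L) (v : Fin k → L),
      invol (f * g) k v = (invol f * invol g) k v := by
    intro k
    induction k with
    | zero => intro f g v; simp [mul_zero_apply]
    | succ k ih =>
      intro f g v
      refine apply_succ_eq (fun x v => ?_) v
      simp only [contr_mul, contr_invol, invol_add, neg_apply, add_apply, ih, neg_mul']
      have h2 : (invol (invol f) * -invol (contr x g)) k v
          = -(invol (invol f) * invol (contr x g)) k v := by
        have := mul_smul' (-1 : R) (invol (invol f)) (invol (contr x g))
        rw [neg_one_smul, neg_one_smul] at this
        rw [this]; rfl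
      rw [h2]; ring
  exact ext_apply fun k v => h k f g v

theorem mul_assoc' (f g h : Forms R L) : f * g * h = f * (g * h) := by
  have H : ∀ (k : ℕ) (f g h : Forms R L) (v : Fin k → L),
      (f * g * h) k v = (f * (g * h)) k v := by
    intro k
    induction k with
    | zero => intro f g h v; simp [mul_zero_apply, mul_assoc]
    | succ k ih =>
      intro f g h v
      refine apply_succ_eq (fun x v => ?_) v
      simp only [contr_mul, invol_mul, add_mul', mul_add', add_apply, ih, add_assoc]
  exact ext_apply fun k v => H k f g h v

/-- Families of forms are an associative unital algebra under the cup product. -/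
instance : Ring (Forms R L) :=
  { (inferInstance : AddCommGroup (Forms R L)), (inferInstance : Mul (Forms R L)),
    (inferInstance : One (Forms R L)) with
    left_distrib := mul_add'
    right_distrib := add_mul'
    zero_mul := zero_mul'
    mul_zero := mul_zero'
    mul_assoc := mul_assoc'
    one_mul := one_mul'
    mul_one := mul_one' }

instance : Algebra R (Forms R L) := Algebra.ofModule smul_mul' fun r f g => mul_smul' r f g

/-! ### The Chevalley differential -/

/-- The Chevalley coboundary: in degree `k + 2` it is
`∑_{r < s} (-1)^(r+s) f([v_r, v_s], v_1, …, v̂_r, …, v̂_s, …, v_{k+2})`; the smaller index is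
`r.castSucc`, the larger one is `s.succ`, and `r ≤ s`. In degrees `0` and `1` it vanishes. -/
def dFun (f : Forms R L) : ∀ k : ℕ, (Fin k → L) → R
  | 0, _ => 0
  | 1, _ => 0
  | k + 2, v => ∑ s : Fin (k + 1), ∑ r : Fin (k + 1),
      if r ≤ s then (-1 : R) ^ ((r : ℕ) + (s : ℕ) + 1) *
        f (k + 1) (Fin.cons ⁅v r.castSucc, v s.succ⁆ fun a => v (s.succ.succAbove (r.succAbove a)))
      else 0

/-- The Lie derivative of forms. -/
def lieFun (x : L) (f : Forms R L) (k : ℕ) (v : Fin k → L) : R :=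
  -∑ i : Fin k, f k (Function.update v i ⁅x, v i⁆)

theorem lieFun_cons (x y : L) (f : Forms R L) (k : ℕ) (v : Fin k → L) :
    lieFun x f (k + 1) (Fin.cons y v) =
      lieFun x (contr y f) k v - contr ⁅x, y⁆ f k v := by
  unfold lieFun
  rw [Fin.sum_univ_succ]
  simp only [Fin.cons_zero, Fin.cons_succ, Fin.update_cons_zero, ← Fin.cons_update, contr_apply]
  ring

theorem exists_lie (x : L) (k : ℕ) : ∀ f : Forms R L,
    ∃ A : L [⋀^Fin k]→ₗ[R] R, ∀ v, A v = lieFun x f k v := by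
  induction k with
  | zero => exact fun f => ⟨0, fun v => by simp [lieFun]⟩
  | succ k ih =>
    intro f
    choose A hA using ih
    have hadd : ∀ (f g : Forms R L) v, lieFun x (f + g) k v = lieFun x f k v + lieFun x g k v := by
      intro f g v
      simp only [lieFun, add_apply, Finset.sum_add_distrib]; ring
    have hsmul : ∀ (r : R) (f : Forms R L) v, lieFun x (r • f) k v = r * lieFun x f k v := by
      intro r f v
      simp only [lieFun, smul_apply, ← Finset.mul_sum]; ring
    refine exists_form (fun y => A (contr y f) - contr ⁅x, y⁆ f k) ?_ ?_ ?_ _ ?_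
    · intro y z v
      simp only [AlternatingMap.sub_apply, hA, contr_add_left, hadd, lie_add, add_apply]
      ring
    · intro r y v
      simp only [AlternatingMap.sub_apply, hA, contr_smul_left, hsmul, lie_smul, smul_apply]
      ring
    · intro y v j hj hv
      cases k with
      | zero => exact j.elim0
      | succ k =>
        have hj0 : j = 0 := Fin.ext hj
        subst hj0
        have hvx : v = Fin.cons y (Fin.tail v) := by rw [← hv, Fin.cons_self_tail]
        rw [hvx]
        simp only [AlternatingMap.sub_apply, hA, lieFun_cons, contr_self]
        rw [← contr_apply y (contr ⁅x, y⁆ f), contr_comm y]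
        simp [lieFun]
    · intro y v
      rw [lieFun_cons, AlternatingMap.sub_apply, hA]

/-- The Lie derivative as a family of forms. -/
noncomputable def lieDer (x : L) (f : Forms R L) : Forms R L :=
  fun k => Classical.choose (exists_lie x k f)

theorem lieDer_apply (x : L) (f : Forms R L) (k : ℕ) (v : Fin k → L) :
    lieDer x f k v = lieFun x f k v := Classical.choose_spec (exists_lie x k f) v

theorem lieDer_add (x : L) (f g : Forms R L) : lieDer x (f + g) = lieDer x f + lieDer x g :=
  ext_apply fun k v => by
    simp only [lieDer_apply, lieFun, add_apply, Finset.sum_add_distrib]; ring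
theorem lieDer_smul (x : L) (r : R) (f : Forms R L) : lieDer x (r • f) = r • lieDer x f :=
  ext_apply fun k v => by
    simp only [lieDer_apply, lieFun, smul_apply, ← Finset.mul_sum]; ring
theorem lieDer_sub (x : L) (f g : Forms R L) : lieDer x (f - g) = lieDer x f - lieDer x g := by
  rw [sub_eq_add_neg, sub_eq_add_neg, lieDer_add, ← neg_one_smul R g, lieDer_smul, neg_one_smul]
theorem lieDer_invol (x : L) (f : Forms R L) : lieDer x (invol f) = invol (lieDer x f) :=
  ext_apply fun k v => by
    simp only [lieDer_apply, lieFun, invol_apply, ← Finset.mul_sum]; ring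
theorem lieDer_add_left (x y : L) (f : Forms R L) : lieDer (x + y) f = lieDer x f + lieDer y f :=
  ext_apply fun k v => by
    simp only [lieDer_apply, lieFun, add_apply, add_lie, AlternatingMap.map_update_add,
      Finset.sum_add_distrib]
    ring
theorem lieDer_smul_left (r : R) (x : L) (f : Forms R L) : lieDer (r • x) f = r • lieDer x f :=
  ext_apply fun k v => by
    simp only [lieDer_apply, lieFun, smul_apply, smul_lie, AlternatingMap.map_update_smul,
      smul_eq_mul, ← Finset.mul_sum]
    ring
theorem contr_lieDer (x y : L) (f : Forms R L) :
    contr y (lieDer x f) = lieDer x (contr y f) - contr ⁅x, y⁆ f :=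
  ext_apply fun k v => by
    rw [contr_apply, lieDer_apply, lieFun_cons, sub_apply, lieDer_apply]
theorem lieDer_zero_apply (x : L) (f : Forms R L) (v : Fin 0 → L) : lieDer x f 0 v = 0 := by
  rw [lieDer_apply]; simp [lieFun]

theorem cons_succAbove {k : ℕ} (f : L [⋀^Fin (k + 1)]→ₗ[R] R) (i : Fin (k + 1)) (y : L)
    (v : Fin (k + 1) → L) :
    f (Fin.cons y fun a => v (i.succAbove a)) = (-1 : R) ^ (i : ℕ) * f (Function.update v i y) := by
  have h := f.map_insertNth i y (fun a => v (i.succAbove a))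
  have h2 : i.insertNth y (fun a => v (i.succAbove a)) = Function.update v i y := by
    rw [← Fin.insertNth_removeNth]
    rfl
  rw [h2] at h
  rw [h]
  change _ = (-1 : R) ^ (i : ℕ) * ((-1 : ℤ) ^ (i : ℕ) • f (Fin.cons y fun a => v (i.succAbove a)))
  rw [zsmul_eq_mul, ← mul_assoc]
  push_cast
  rw [← mul_pow]
  simp

theorem dFun_cons (f : Forms R L) (k : ℕ) (x : L) (v : Fin k → L) :
    dFun f (k + 1) (Fin.cons x v) = lieDer x f k v - dFun (contr x f) k v := by
  rcases k with _ | k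
  · simp [dFun, lieDer_zero_apply]
  have key : ∀ (s : Fin (k + 1)), (-1 : R) ^ ((0 : ℕ) + (s : ℕ) + 1) *
      f (k + 1) (Fin.cons ⁅(Fin.cons x v : Fin (k + 2) → L) (0 : Fin (k + 1)).castSucc,
          (Fin.cons x v : Fin (k + 2) → L) s.succ⁆
        fun a => (Fin.cons x v : Fin (k + 2) → L) (s.succ.succAbove ((0 : Fin (k + 1)).succAbove a)))
      = -f (k + 1) (Function.update v s ⁅x, v s⁆) := by
    intro s
    have h1 : (fun a : Fin k => (Fin.cons x v : Fin (k + 2) → L)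
        (s.succ.succAbove ((0 : Fin (k + 1)).succAbove a))) = fun a => v (s.succAbove a) := by
      funext a
      rw [Fin.zero_succAbove, Fin.succ_succAbove_succ, Fin.cons_succ]
    rw [h1, Fin.castSucc_zero, Fin.cons_zero, Fin.cons_succ, cons_succAbove, ← mul_assoc,
      ← pow_add]
    have : (-1 : R) ^ (0 + (s : ℕ) + 1 + (s : ℕ)) = -1 :=
      Odd.neg_one_pow ⟨(s : ℕ), by ring⟩
    rw [this, neg_one_mul]
  rw [lieDer_apply]
  unfold lieFun
  rw [← Finset.sum_neg_distrib, sub_eq_add_neg]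
  change (∑ s : Fin (k + 1), ∑ r : Fin (k + 1), _) = _
  rw [Finset.sum_congr rfl fun s _ => Fin.sum_univ_succ _, Finset.sum_add_distrib]
  congr 1
  · refine Finset.sum_congr rfl fun s _ => ?_
    rw [if_pos (Fin.zero_le s), ← key s]
    rfl
  · rcases k with _ | k
    · simp [dFun]
    · rw [Fin.sum_univ_succ]
      have h0 : ∀ r : Fin (k + 1), ¬ (r.succ ≤ (0 : Fin (k + 2))) := fun r h =>
        Fin.succ_ne_zero r (Fin.le_zero_iff.1 h)
      simp only [h0, if_false, Finset.sum_const_zero, zero_add, Fin.succ_le_succ_iff]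
      simp only [dFun]
      rw [← Finset.sum_neg_distrib]
      refine Finset.sum_congr rfl fun s _ => ?_
      rw [← Finset.sum_neg_distrib]
      refine Finset.sum_congr rfl fun r _ => ?_
      split_ifs with hrs
      · rw [← Fin.succ_castSucc, Fin.cons_succ, Fin.cons_succ, contr_apply]
        have h1 : (fun a : Fin (k + 1) => (Fin.cons x v : Fin (k + 3) → L)
            (s.succ.succ.succAbove (r.succ.succAbove a))) =
            Fin.cons x fun a => v (s.succ.succAbove (r.succAbove a)) := by
          funext a
          refine Fin.cases ?_ (fun a => ?_) a
          · simp
          · rw [Fin.succ_succAbove_succ, Fin.succ_succAbove_succ, Fin.cons_succ, Fin.cons_succ]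
        rw [h1]
        have h2 := congrArg (fun g : Forms R L => g k fun a => v (s.succ.succAbove (r.succAbove a)))
          (contr_comm ⁅v r.castSucc, v s.succ⁆ x f)
        simp only [neg_apply, contr_apply] at h2 ⊢
        rw [← neg_eq_iff_eq_neg] at h2
        rw [← h2]
        simp only [Fin.val_succ, pow_add, pow_one]
        ring
      · simp

theorem dFun_add (f g : Forms R L) (k : ℕ) (v : Fin k → L) :
    dFun (f + g) k v = dFun f k v + dFun g k v := by
  match k, v with
  | 0, _ => simp [dFun]
  | 1, _ => simp [dFun]
  | k + 2, v =>
    simp only [dFun, ← Finset.sum_add_distrib]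
    refine Finset.sum_congr rfl fun s _ => Finset.sum_congr rfl fun r _ => ?_
    split_ifs
    · rw [add_apply]; ring
    · ring

theorem dFun_smul (c : R) (f : Forms R L) (k : ℕ) (v : Fin k → L) :
    dFun (c • f) k v = c * dFun f k v := by
  match k, v with
  | 0, _ => simp [dFun]
  | 1, _ => simp [dFun]
  | k + 2, v =>
    simp only [dFun, Finset.mul_sum]
    refine Finset.sum_congr rfl fun s _ => Finset.sum_congr rfl fun r _ => ?_
    split_ifs
    · rw [smul_apply]; ring
    · ring

theorem exists_d (k : ℕ) : ∀ f : Forms R L,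
    ∃ A : L [⋀^Fin k]→ₗ[R] R, ∀ v, A v = dFun f k v := by
  induction k with
  | zero => exact fun f => ⟨0, fun v => rfl⟩
  | succ k ih =>
    intro f
    choose A hA using ih
    refine exists_form (fun x => lieDer x f k - A (contr x f)) ?_ ?_ ?_ _ ?_
    · intro x y v
      simp only [AlternatingMap.sub_apply, hA, contr_add_left, dFun_add, lieDer_add_left,
        add_apply]
      ring
    · intro r x v
      simp only [AlternatingMap.sub_apply, hA, contr_smul_left, dFun_smul, lieDer_smul_left,
        smul_apply]
      ring
    · intro x v j hj hv
      cases k with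
      | zero => exact j.elim0
      | succ k =>
        have hj0 : j = 0 := Fin.ext hj
        subst hj0
        have hvx : v = Fin.cons x (Fin.tail v) := by rw [← hv, Fin.cons_self_tail]
        rw [hvx]
        have h0 : dFun (0 : Forms R L) k (Fin.tail v) = 0 := by
          simpa using dFun_smul 0 (0 : Forms R L) k (Fin.tail v)
        simp only [AlternatingMap.sub_apply, hA, dFun_cons, contr_self, h0]
        rw [← contr_apply x (lieDer x f), contr_lieDer, lie_self]
        have h1 : contr (0 : L) f = 0 := by simpa using contr_smul_left (0 : R) (0 : L) f
        rw [h1]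
        simp
    · intro x v
      rw [dFun_cons, AlternatingMap.sub_apply, hA]

variable (R L) in
/-- The Chevalley differential on families of forms. -/
def d : Forms R L →ₗ[R] Forms R L where
  toFun f := fun k =>
    { toFun := dFun f k
      map_update_add' := by
        obtain ⟨A, hA⟩ := exists_d k f
        intro _ m i x y
        rw [← hA, ← hA, ← hA]
        convert A.map_update_add m i x y
      map_update_smul' := by
        obtain ⟨A, hA⟩ := exists_d k f
        intro _ m i r x
        rw [← hA, ← hA]
        convert A.map_update_smul m i r x
      map_eq_zero_of_eq' := by
        obtain ⟨A, hA⟩ := exists_d k f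
        intro v i j hv hij
        rw [← hA]
        exact A.map_eq_zero_of_eq v hv hij }
  map_add' f g := ext_apply fun k v => dFun_add f g k v
  map_smul' r f := ext_apply fun k v => dFun_smul r f k v

theorem d_apply (f : Forms R L) (k : ℕ) (v : Fin k → L) : d R L f k v = dFun f k v := rfl
theorem d_zero_apply (f : Forms R L) (v : Fin 0 → L) : d R L f 0 v = 0 := rfl
theorem contr_d (x : L) (f : Forms R L) : contr x (d R L f) = lieDer x f - d R L (contr x f) :=
  ext_apply fun k v => by
    rw [contr_apply, d_apply, dFun_cons, sub_apply, d_apply]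

theorem lieDer_lieDer (x y : L) (f : Forms R L) :
    lieDer x (lieDer y f) - lieDer y (lieDer x f) = lieDer ⁅x, y⁆ f := by
  have H : ∀ (k : ℕ) (f : Forms R L) (v : Fin k → L),
      (lieDer x (lieDer y f) - lieDer y (lieDer x f)) k v = lieDer ⁅x, y⁆ f k v := by
    intro k
    induction k with
    | zero => intro f v; simp [lieDer_zero_apply]
    | succ k ih =>
      intro f v
      refine apply_succ_eq (fun z v => ?_) v
      have h := ih (contr z f) v
      have h2 : contr ⁅x, ⁅y, z⁆⁆ f = contr ⁅⁅x, y⁆, z⁆ f + contr ⁅y, ⁅x, z⁆⁆ f := by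
        rw [leibniz_lie, contr_add_left]
      have h3 := congrArg (fun g : Forms R L => g k v) h2
      simp only [contr_sub, contr_lieDer, lieDer_sub, sub_apply, add_apply] at h h3 ⊢
      linear_combination h - h3
  exact ext_apply fun k v => H k f v

theorem lieDer_d (x : L) (f : Forms R L) : lieDer x (d R L f) = d R L (lieDer x f) := by
  have H : ∀ (k : ℕ) (f : Forms R L) (v : Fin k → L),
      lieDer x (d R L f) k v = d R L (lieDer x f) k v := by
    intro k
    induction k with
    | zero => intro f v; simp [lieDer_zero_apply, d_zero_apply]
    | succ k ih =>
      intro f v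
      refine apply_succ_eq (fun y v => ?_) v
      have h := ih (contr y f) v
      have h2 := congrArg (fun g : Forms R L => g k v) (lieDer_lieDer x y f)
      simp only [contr_lieDer, contr_d, lieDer_sub, map_sub, sub_apply] at h h2 ⊢
      linear_combination h2 - h
  exact ext_apply fun k v => H k f v

/-- The square of the Chevalley differential is zero. -/
theorem d_d (f : Forms R L) : d R L (d R L f) = 0 := by
  have H : ∀ (k : ℕ) (f : Forms R L) (v : Fin k → L), d R L (d R L f) k v = 0 := by
    intro k
    induction k with
    | zero => intro f v; rfl
    | succ k ih =>
      intro f v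
      refine apply_succ_eq (g := 0) (fun y v => ?_) v
      have h := ih (contr y f) v
      simp only [contr_d, map_sub, lieDer_d, sub_apply] at h ⊢
      rw [h]
      change _ = (0 : R)
      ring
  exact ext_apply fun k v => H k f v

theorem lieDer_mul (x : L) (f g : Forms R L) :
    lieDer x (f * g) = lieDer x f * g + f * lieDer x g := by
  have H : ∀ (k : ℕ) (f g : Forms R L) (v : Fin k → L),
      lieDer x (f * g) k v = (lieDer x f * g + f * lieDer x g) k v := by
    intro k
    induction k with
    | zero => intro f g v; simp [lieDer_zero_apply, mul_zero_apply]
    | succ k ih =>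
      intro f g v
      refine apply_succ_eq (fun y v => ?_) v
      have h1 := ih (contr y f) g v
      have h2 := ih (invol f) (contr y g) v
      simp only [contr_lieDer, contr_mul, contr_add, lieDer_add, lieDer_invol,
        sub_mul, mul_sub, add_apply, sub_apply] at h1 h2 ⊢
      linear_combination h1 + h2
  exact ext_apply fun k v => H k f g v

theorem d_invol (f : Forms R L) : d R L (invol f) = -invol (d R L f) := by
  have H : ∀ (k : ℕ) (f : Forms R L) (v : Fin k → L),
      d R L (invol f) k v = (-invol (d R L f)) k v := by
    intro k
    induction k with
    | zero => intro f v; simp [d_zero_apply]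
    | succ k ih =>
      intro f v
      refine apply_succ_eq (fun y v => ?_) v
      have h1 := ih (contr y f) v
      simp only [contr_d, contr_neg, contr_invol, lieDer_invol, invol_sub, map_neg, sub_apply,
        neg_apply] at h1 ⊢
      linear_combination h1
  exact ext_apply fun k v => H k f v

/-- The Chevalley differential is a graded derivation for the cup product. -/
theorem d_mul (f g : Forms R L) : d R L (f * g) = d R L f * g + invol f * d R L g := by
  have H : ∀ (k : ℕ) (f g : Forms R L) (v : Fin k → L),
      d R L (f * g) k v = (d R L f * g + invol f * d R L g) k v := by
    intro k
    induction k with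
    | zero => intro f g v; simp [d_zero_apply, mul_zero_apply]
    | succ k ih =>
      intro f g v
      refine apply_succ_eq (fun y v => ?_) v
      have h1 := ih (contr y f) g v
      have h2 := ih (invol f) (contr y g) v
      simp only [contr_d, contr_mul, contr_add, contr_invol, lieDer_mul, d_invol, invol_invol,
        map_add, sub_mul, mul_sub, neg_mul, add_apply, sub_apply, neg_apply] at h1 h2 ⊢
      linear_combination -h1 - h2
  exact ext_apply fun k v => H k f g v

theorem d_one : d R L (1 : Forms R L) = 0 := by
  have h := d_mul (1 : Forms R L) 1
  rw [invol_one, mul_one, mul_one, one_mul] at h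
  exact left_eq_add.1 h

end Forms

/-! ### Cochains and cohomology -/

open Forms

variable (R L) in
/-- The Chevalley cochain algebra `⨁ k, Hom(⋀^k L, R)`: the families of forms with only finitely
many nonzero members. -/
def cochains : Subalgebra R (Forms R L) where
  carrier := {f | ∃ N, ∀ k, N ≤ k → f k = 0}
  mul_mem' := by
    rintro f g ⟨M, hM⟩ ⟨N, hN⟩
    refine ⟨M + N, fun k hk => AlternatingMap.ext fun v => ?_⟩
    rw [mul_apply]
    refine Finset.sum_eq_zero fun S _ => ?_
    by_cases h : M ≤ S.card
    · simp [evalOn, hM _ h]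
    · have : N ≤ Sᶜ.card := by
        rw [Finset.card_compl, Fintype.card_fin]; omega
      simp [evalOn, hN _ this]
  add_mem' := by
    rintro f g ⟨M, hM⟩ ⟨N, hN⟩
    refine ⟨M + N, fun k hk => AlternatingMap.ext fun v => ?_⟩
    rw [Forms.add_apply, hM k (by omega), hN k (by omega)]
    simp
  algebraMap_mem' r := by
    refine ⟨1, fun k hk => ?_⟩
    rw [Algebra.algebraMap_eq_smul_one]
    cases k with
    | zero => omega
    | succ k => exact smul_zero r

theorem invol_mem_cochains {f : Forms R L} (hf : f ∈ cochains R L) : invol f ∈ cochains R L := by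
  obtain ⟨N, hN⟩ := hf
  exact ⟨N, fun k hk => AlternatingMap.ext fun v => by rw [invol_apply, hN k hk]; simp⟩

theorem d_mem_cochains {f : Forms R L} (hf : f ∈ cochains R L) : d R L f ∈ cochains R L := by
  obtain ⟨N, hN⟩ := hf
  refine ⟨N + 2, fun k hk => AlternatingMap.ext fun v => ?_⟩
  obtain ⟨k, rfl⟩ : ∃ j, k = j + 2 := ⟨k - 2, by omega⟩
  rw [d_apply]
  simp [dFun, hN (k + 1) (by omega)]

variable (R L) in
/-- The algebra of Chevalley cocycles. -/
def cocycles : Subalgebra R (Forms R L) where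
  carrier := {f | f ∈ cochains R L ∧ d R L f = 0}
  mul_mem' := by
    rintro f g ⟨hf, hf'⟩ ⟨hg, hg'⟩
    exact ⟨mul_mem hf hg, by rw [d_mul, hf', hg', zero_mul, mul_zero, add_zero]⟩
  add_mem' := by
    rintro f g ⟨hf, hf'⟩ ⟨hg, hg'⟩
    exact ⟨add_mem hf hg, by rw [map_add, hf', hg', add_zero]⟩
  algebraMap_mem' r := by
    refine ⟨Subalgebra.algebraMap_mem _ r, ?_⟩
    rw [Algebra.algebraMap_eq_smul_one, map_smul, d_one, smul_zero]

variable (R L) in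
/-- The ideal of Chevalley coboundaries in the algebra of cocycles. -/
def coboundaries : Ideal (cocycles R L) where
  carrier := {z | ∃ f ∈ cochains R L, d R L f = z}
  add_mem' := by
    rintro z w ⟨f, hf, hz⟩ ⟨g, hg, hw⟩
    exact ⟨f + g, add_mem hf hg, by rw [map_add, hz, hw]; rfl⟩
  zero_mem' := ⟨0, zero_mem _, map_zero _⟩
  smul_mem' := by
    rintro ⟨z, hz, hz'⟩ ⟨w, hw⟩ ⟨f, hf, hfw⟩
    refine ⟨invol z * f, mul_mem (invol_mem_cochains hz) hf, ?_⟩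
    change d R L f = w at hfw
    have h0 : invol (0 : Forms R L) = 0 := by simpa using invol_smul (0 : R) (0 : Forms R L)
    have h1 : d R L (invol z * f) = z * w := by
      rw [d_mul, d_invol, hz', invol_invol, hfw, h0, neg_zero, zero_mul, zero_add]
    exact h1

instance : (coboundaries R L).IsTwoSided where
  mul_mem_of_left := by
    rintro ⟨w, hw⟩ ⟨z, hz, hz'⟩ ⟨f, hf, hfw⟩
    refine ⟨f * z, mul_mem hf hz, ?_⟩
    change d R L f = w at hfw
    have h1 : d R L (f * z) = w * z := by rw [d_mul, hz', mul_zero, add_zero, hfw]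
    exact h1

variable (R L) in
/-- The Chevalley cohomology algebra `H^*(L)` of `L` with trivial coefficients `R`, under the cup
product. -/
abbrev Cohomology : Type _ := cocycles R L ⧸ coboundaries R L

variable (R L) in
/-- The degree `k` part `H^k(L)`: the classes of the cocycles that are concentrated in degree
`k`. -/
def cohomologyDegree (k : ℕ) : Submodule R (Cohomology R L) where
  carrier := {c | ∃ z : cocycles R L, (∀ l, l ≠ k → (z : Forms R L) l = 0) ∧
    Ideal.Quotient.mk (coboundaries R L) z = c}
  add_mem' := by
    rintro _ _ ⟨z, hz, rfl⟩ ⟨w, hw, rfl⟩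
    refine ⟨z + w, fun l hl => ?_, map_add _ _ _⟩
    change (z : Forms R L) l + (w : Forms R L) l = 0
    rw [hz l hl, hw l hl, add_zero]
  zero_mem' := ⟨0, fun _ _ => rfl, map_zero _⟩
  smul_mem' := by
    rintro r _ ⟨z, hz, rfl⟩
    refine ⟨r • z, fun l hl => ?_, rfl⟩
    change r • (z : Forms R L) l = 0
    rw [hz l hl, smul_zero]

/-- The form `f` is a cocycle that represents the cohomology class `c`. -/
def Represents (f : Forms R L) (c : Cohomology R L) : Prop :=
  ∃ h : f ∈ cocycles R L, Ideal.Quotient.mk (coboundaries R L) ⟨f, h⟩ = c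

/-- A linear functional on `L` as a family of forms concentrated in degree one. -/
def ofDual (ξ : L →ₗ[R] R) : Forms R L :=
  Pi.single 1 (AlternatingMap.ofSubsingleton R L R (0 : Fin 1) ξ)

end Forms

/-! ### Poset-triangular matrices -/

section Matrices

attribute [local instance 100] LieRing.ofAssociativeRing

variable (R P : Type*) [CommRing R] [Fintype P] [DecidableEq P] [PartialOrder P]

/-- The Lie algebra of the matrices `a` indexed by the finite poset `P` with `a i j = 0` unless
`i ≤ j`, with the commutator bracket. -/
def glPoset : LieSubalgebra R (Matrix P P R) where
  carrier := {a | ∀ i j, ¬ i ≤ j → a i j = 0}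
  add_mem' := by
    intro a b ha hb i j hij
    rw [Matrix.add_apply, ha i j hij, hb i j hij, add_zero]
  zero_mem' := fun _ _ _ => rfl
  smul_mem' := by
    intro r a ha i j hij
    rw [Matrix.smul_apply, ha i j hij, smul_zero]
  lie_mem' := by
    have hmul : ∀ a b : Matrix P P R, (∀ i j, ¬ i ≤ j → a i j = 0) → (∀ i j, ¬ i ≤ j → b i j = 0) →
        ∀ i j, ¬ i ≤ j → (a * b) i j = 0 := by
      intro a b ha hb i j hij
      rw [Matrix.mul_apply]
      refine Finset.sum_eq_zero fun l _ => ?_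
      by_cases h : i ≤ l
      · rw [hb l j fun h' => hij (h.trans h'), mul_zero]
      · rw [ha i l h, zero_mul]
    intro a b ha hb i j hij
    rw [Ring.lie_def, Matrix.sub_apply, hmul a b ha hb i j hij, hmul b a hb ha i j hij, sub_zero]

variable {P}

/-- The 1-cochain `a ↦ a i j` on poset-triangular matrices; for `i ≤ j` it is the member dual to
`e_ij` of the basis dual to `{e_kl | k ≤ l}`. -/
def entry (i j : P) : Forms R (glPoset R P) :=
  ofDual ((Matrix.entryLinearMap R R i j).comp (glPoset R P).toSubmodule.subtype)

end Matrices

/-! ### Exterior algebras with generators in prescribed degrees -/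

section Exterior

variable (R : Type*) [CommRing R]

/-- The exterior algebra `Λ_R[x_i | i ∈ I]`. -/
abbrev Ext (I : Type*) : Type _ := ExteriorAlgebra R (I →₀ R)

variable {I : Type*}

/-- The generator `x_i`. -/
noncomputable abbrev gen (i : I) : Ext R I := ExteriorAlgebra.ι R (Finsupp.single i 1)

/-- The degree `k` part of `Λ_R[x_i | i ∈ I]` when `x_i` has degree `δ i`: the span of the products
`x_{i_1} ⋯ x_{i_m}` with `δ i_1 + ⋯ + δ i_m = k`. -/
noncomputable def extDegree (δ : I → ℕ) (k : ℕ) : Submodule R (Ext R I) :=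
  Submodule.span R {w | ∃ l : List I, (l.map δ).sum = k ∧ w = (l.map (gen R)).prod}

end Exterior

end Chevalley

/-! The Lie derivatives along the diagonal matrix units `e_vv` act diagonally on exterior products
of the coordinate functionals: on the product over a list of positions `(i, j)`, the eigenvalue is
minus the weight at `v`, the number of positions in row `v` minus the number of positions in column
`v`. By Cartan's formula `L_x = d ι_x + ι_x d`, these operators are zero on cohomology, so only the
part of weight zero over the prime field contributes: for each nonzero weight `w`, the operator
`1 + w⁻¹ • L` kills the eigenvectors of weight `w` and is homotopic to the identity. The product of
finitely many such operators is the projector `weightFilter` onto the part of weight zero.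

A set of strict relations whose weights all vanish is balanced modulo the characteristic. A vertex
of a nonempty set that is minimal among the sources of arrows has positive weight, at most `n - 1`
(`exists_weight_eq_of_ne_nil`). In characteristic `0` or `p ≥ n` this excludes nonempty sets. For
`p = n - 1` this weight has to be `p`, hence the vertex is a least element joined to all others;
dually there is a greatest element. What remains after the removal of the diamond formed by the
arrows `a → b`, `a → x`, `x → b` is again balanced, and so it is empty
(`perm_diamond_of_weightZero`). Thus the part of weight zero is the exterior algebra on the diagonal
coordinates and, where it exists, on the exterior product `y` over the diamond.

The differential vanishes on this part. For `y` the reason is one of degree: `d y` has weight zero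
and does not involve the diagonal coordinates, so it would be a combination of `1` and `y`,
neither of which has its degree (`d_wedge_eq_zero`). That the comparison map from the abstract exterior algebra is injective is seen
by contraction with matrix units (`injective_of_contractions`), and that exterior products of
coordinates span all forms is seen by splitting off one coordinate at a time
(`mem_sublistSpan_of_contr_eq_zero`). -/

namespace Chevalley

/-! ### Homogeneous forms, forms of degree one, and filtering by Lie derivatives -/

namespace Forms

section General

variable {R L : Type*} [CommRing R] [LieRing L] [LieAlgebra R L]

/-- Forms are determined by their constant term and their contractions. -/
theorem ext_contr {f g : Forms R L} (h0 : ∀ v, f 0 v = g 0 v)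
    (h : ∀ x, contr x f = contr x g) : f = g := by
  refine ext_apply fun k v => ?_
  cases k with
  | zero => exact h0 v
  | succ k => exact apply_succ_eq (fun x v => by rw [h x]) v

/-- The form `f` is concentrated in degree `k`. -/
def IsHomogeneous (k : ℕ) (f : Forms R L) : Prop := ∀ l, l ≠ k → f l = 0

theorem isHomogeneous_one : IsHomogeneous 0 (1 : Forms R L) := fun _ hl => Pi.single_eq_of_ne hl _

theorem isHomogeneous_ofDual (ξ : L →ₗ[R] R) : IsHomogeneous 1 (ofDual ξ) :=
  fun _ hl => Pi.single_eq_of_ne hl _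

theorem IsHomogeneous.add {k : ℕ} {f g : Forms R L} (hf : IsHomogeneous k f)
    (hg : IsHomogeneous k g) : IsHomogeneous k (f + g) := fun l hl => by
  change f l + g l = 0
  rw [hf l hl, hg l hl, add_zero]

theorem IsHomogeneous.smul {k : ℕ} {f : Forms R L} (r : R) (hf : IsHomogeneous k f) :
    IsHomogeneous k (r • f) := fun l hl => by
  change r • f l = 0
  rw [hf l hl, smul_zero]

theorem IsHomogeneous.mul {k m : ℕ} {f g : Forms R L} (hf : IsHomogeneous k f)
    (hg : IsHomogeneous m g) : IsHomogeneous (k + m) (f * g) := fun l hl => by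
  refine AlternatingMap.ext fun v => ?_
  rw [mul_apply]
  refine Finset.sum_eq_zero fun S _ => ?_
  by_cases h : S.card = k
  · have : Sᶜ.card ≠ m := by
      have h1 := Finset.card_add_card_compl S
      rw [Fintype.card_fin] at h1
      omega
    simp [evalOn, hg _ this]
  · simp [evalOn, hf _ h]

theorem IsHomogeneous.lieDer {k : ℕ} {f : Forms R L} (x : L) (hf : IsHomogeneous k f) :
    IsHomogeneous k (lieDer x f) := fun l hl => by
  refine AlternatingMap.ext fun v => ?_
  rw [lieDer_apply]
  simp [lieFun, hf l hl]

theorem IsHomogeneous.d {k : ℕ} {f : Forms R L} (hf : IsHomogeneous k f) :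
    IsHomogeneous (k + 1) (d R L f) := fun l hl => by
  refine AlternatingMap.ext fun v => ?_
  rw [d_apply]
  match l, v with
  | 0, _ => rfl
  | 1, _ => rfl
  | l + 2, v => simp [dFun, hf (l + 1) (by omega)]

theorem IsHomogeneous.mem_cochains {k : ℕ} {f : Forms R L} (hf : IsHomogeneous k f) :
    f ∈ cochains R L := ⟨k + 1, fun l hl => hf l (by omega)⟩

variable (R L) in
/-- The projection of a family of forms to its member of degree `k`. -/
def component (k : ℕ) : Forms R L →ₗ[R] Forms R L where
  toFun f := fun l => if l = k then f l else 0
  map_add' f g := funext fun l => by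
    change (if l = k then f l + g l else 0) = (if l = k then f l else 0) + if l = k then g l else 0
    split_ifs <;> simp
  map_smul' r f := funext fun l => by
    change (if l = k then r • f l else 0) = r • (if l = k then f l else 0)
    split_ifs <;> simp

theorem IsHomogeneous.component_self {k : ℕ} {f : Forms R L} (hf : IsHomogeneous k f) :
    component R L k f = f := funext fun l => by
  change (if l = k then f l else 0) = f l
  split_ifs with h
  · rfl
  · exact (hf l h).symm

theorem IsHomogeneous.component_of_ne {k m : ℕ} (h : m ≠ k) {f : Forms R L}
    (hf : IsHomogeneous m f) : component R L k f = 0 := funext fun l => by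
  change (if l = k then f l else 0) = 0
  split_ifs with h'
  · exact hf l (by omega)
  · rfl

theorem contr_ofDual (x : L) (ξ : L →ₗ[R] R) : contr x (ofDual ξ) = ξ x • 1 := by
  refine ext_apply fun k v => ?_
  rw [contr_apply, smul_apply]
  cases k with
  | zero =>
    rw [one_zero_apply, mul_one]
    rfl
  | succ k =>
    rw [isHomogeneous_ofDual ξ (k + 1 + 1) (by omega), isHomogeneous_one (k + 1) (by omega)]
    simp

theorem ofDual_zero_apply (ξ : L →ₗ[R] R) (v : Fin 0 → L) : ofDual ξ 0 v = 0 := rfl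

theorem invol_ofDual (ξ : L →ₗ[R] R) : invol (ofDual ξ) = -ofDual ξ := by
  refine ext_contr (fun v => by simp [ofDual_zero_apply]) fun x => ?_
  rw [contr_invol, contr_neg, contr_ofDual, invol_smul, invol_one]

/-- A form of degree one anticommutes with odd forms and commutes with even ones. -/
theorem ofDual_mul (ξ : L →ₗ[R] R) (g : Forms R L) : ofDual ξ * g = invol g * ofDual ξ := by
  have H : ∀ (k : ℕ) (g : Forms R L) (v : Fin k → L),
      (ofDual ξ * g) k v = (invol g * ofDual ξ) k v := by
    intro k
    induction k with
    | zero => intro g v; simp [mul_zero_apply, ofDual_zero_apply]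
    | succ k ih =>
      intro g v
      refine apply_succ_eq (fun x v => ?_) v
      have h := ih (contr x g) v
      simp only [contr_mul, contr_ofDual, invol_ofDual, contr_invol, invol_invol, neg_mul,
        smul_mul_assoc, mul_smul_comm, one_mul, mul_one, add_apply, neg_apply] at h ⊢
      linear_combination -h
  exact ext_apply fun k v => H k g v

theorem ofDual_mul_self (ξ : L →ₗ[R] R) : ofDual ξ * ofDual ξ = 0 := by
  refine ext_contr (fun v => by simp [mul_zero_apply, ofDual_zero_apply]) fun x => ?_
  rw [contr_mul, contr_ofDual, invol_ofDual, smul_mul_assoc, one_mul, mul_smul_comm, mul_one,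
    smul_neg, add_neg_cancel]
  rfl

theorem lieDer_ofDual (x : L) (ξ : L →ₗ[R] R) :
    lieDer x (ofDual ξ) = -ofDual (ξ.comp (LieAlgebra.ad R L x : L →ₗ[R] L)) := by
  have h1 : ∀ c : R, lieDer x (c • 1 : Forms R L) = 0 := fun c => by
    have h := lieDer_mul x (1 : Forms R L) 1
    rw [mul_one, mul_one, one_mul] at h
    rw [lieDer_smul, left_eq_add.1 h, smul_zero]
  refine ext_contr (fun v => by simp [lieDer_zero_apply, ofDual_zero_apply]) fun y => ?_
  rw [contr_lieDer, contr_neg, contr_ofDual, contr_ofDual, contr_ofDual, h1, zero_sub]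
  rfl

theorem contr_mem_cochains (x : L) {f : Forms R L} (hf : f ∈ cochains R L) :
    contr x f ∈ cochains R L := by
  obtain ⟨N, hN⟩ := hf
  refine ⟨N, fun k hk => AlternatingMap.ext fun v => ?_⟩
  rw [contr_apply, hN (k + 1) (by omega)]
  rfl

/-- The Lie derivative as a linear operator. -/
noncomputable def lieDerLin (x : L) : Module.End R (Forms R L) where
  toFun := lieDer x
  map_add' := lieDer_add x
  map_smul' := lieDer_smul x

theorem lieDerLin_apply (x : L) (f : Forms R L) : lieDerLin x f = lieDer x f := rfl

/-- Contraction as a linear operator. -/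
def contrLin (x : L) : Module.End R (Forms R L) where
  toFun := contr x
  map_add' := contr_add x
  map_smul' := contr_smul x

/-- The product of the operators `1 + c • (Lie derivative along x)` over a list of pairs `(x, c)`.
It plays the role of a projector onto a simultaneous eigenspace of Lie derivatives. -/
noncomputable def filterOp (s : List (L × R)) : Module.End R (Forms R L) :=
  (s.map fun t => 1 + t.2 • lieDerLin t.1).prod

theorem filterOp_nil_apply (f : Forms R L) : filterOp [] f = f := rfl

theorem filterOp_cons_apply (t : L × R) (s : List (L × R)) (f : Forms R L) :
    filterOp (t :: s) f = filterOp s f + t.2 • lieDer t.1 (filterOp s f) := by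
  simp only [filterOp, List.map_cons, List.prod_cons]
  rfl

theorem filterOp_d (s : List (L × R)) (f : Forms R L) :
    filterOp s (d R L f) = d R L (filterOp s f) := by
  induction s with
  | nil => rfl
  | cons t s ih => rw [filterOp_cons_apply, filterOp_cons_apply, ih, lieDer_d, map_add, map_smul]

theorem IsHomogeneous.filterOp {k : ℕ} {f : Forms R L} (hf : IsHomogeneous k f)
    (s : List (L × R)) : IsHomogeneous k (filterOp s f) := by
  induction s with
  | nil => exact hf
  | cons t s ih =>
    rw [filterOp_cons_apply]
    exact ih.add ((ih.lieDer _).smul _)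

/-- By Cartan's formula, `filterOp` does not change the class of a cocycle. -/
theorem exists_sub_filterOp_eq_d (s : List (L × R)) {f : Forms R L} (hf : f ∈ cocycles R L) :
    filterOp s f ∈ cocycles R L ∧ ∃ g ∈ cochains R L, f - filterOp s f = d R L g := by
  induction s with
  | nil => exact ⟨hf, 0, zero_mem _, by rw [filterOp_nil_apply, sub_self, map_zero]⟩
  | cons t s ih =>
    obtain ⟨hs, g, hg, h⟩ := ih
    have hc : lieDer t.1 (filterOp s f) = d R L (contr t.1 (filterOp s f)) := by
      have h2 := contr_d t.1 (filterOp s f)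
      rw [hs.2] at h2
      exact (sub_eq_zero.1 h2.symm)
    have hm := contr_mem_cochains t.1 hs.1
    rw [filterOp_cons_apply]
    refine ⟨add_mem hs (Subalgebra.smul_mem _ ?_ _), g - t.2 • contr t.1 (filterOp s f),
      sub_mem hg (Subalgebra.smul_mem _ hm _), ?_⟩
    · rw [hc]
      exact ⟨d_mem_cochains hm, d_d _⟩
    · rw [map_sub, map_smul, ← h, hc]
      abel

theorem filterOp_eq_self (s : List (L × R)) {f : Forms R L} (h : ∀ t ∈ s, lieDer t.1 f = 0) :
    filterOp s f = f := by
  induction s with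
  | nil => rfl
  | cons t s ih =>
    rw [filterOp_cons_apply, ih fun t ht => h t (List.mem_cons_of_mem _ ht),
      h t List.mem_cons_self, smul_zero, add_zero]

theorem filterOp_eq_zero (s : List (L × R)) {f : Forms R L}
    (h : ∀ t ∈ s, ∃ w : R, lieDer t.1 f = w • f) {t : L × R} (ht : t ∈ s)
    (h0 : f + t.2 • lieDer t.1 f = 0) : filterOp s f = 0 := by
  have heig : ∀ s : List (L × R), (∀ t ∈ s, ∃ w : R, lieDer t.1 f = w • f) →
      ∃ c : R, filterOp s f = c • f := by
    intro s h
    induction s with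
    | nil => exact ⟨1, (one_smul _ _).symm⟩
    | cons t s ih =>
      obtain ⟨c, hc⟩ := ih fun t ht => h t (List.mem_cons_of_mem _ ht)
      obtain ⟨w, hw⟩ := h t List.mem_cons_self
      exact ⟨c + t.2 * c * w, by
        rw [filterOp_cons_apply, hc, lieDer_smul, hw, smul_smul, smul_smul, ← add_smul]⟩
  induction s with
  | nil => simp at ht
  | cons t' s ih =>
    have hs : ∀ t ∈ s, ∃ w : R, lieDer t.1 f = w • f := fun t ht => h t (List.mem_cons_of_mem _ ht)
    rw [filterOp_cons_apply]
    rcases List.mem_cons.1 ht with rfl | ht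
    · obtain ⟨c, hc⟩ := heig s hs
      rw [hc, lieDer_smul, smul_comm, ← smul_add, h0, smul_zero]
    · rw [ih hs ht, ← lieDerLin_apply, map_zero, smul_zero, add_zero]

end General

end Forms

/-! ### Ordered products of anticommuting elements, and exterior algebras -/

section SublistSpan

variable {R A I : Type*} [CommRing R] [Ring A] [Algebra R A]

variable (R) in
/-- The span of the ordered products of the members of a family `x` over the sublists of `t`. -/
def sublistSpan (x : I → A) (t : List I) : Submodule R A :=
  Submodule.span R {w | ∃ l : List I, l.Sublist t ∧ w = (l.map x).prod}

theorem prod_mem_sublistSpan (x : I → A) {l t : List I} (h : l.Sublist t) :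
    (l.map x).prod ∈ sublistSpan R x t := Submodule.subset_span ⟨l, h, rfl⟩

theorem mem_sublistSpan_cons {x : I → A} {i : I} {t : List I} {u : A} :
    u ∈ sublistSpan R x (i :: t) ↔
      ∃ v ∈ sublistSpan R x t, ∃ w ∈ sublistSpan R x t, u = v + x i * w := by
  constructor
  · intro hu
    induction hu using Submodule.span_induction with
    | mem u hu =>
      obtain ⟨l, hl, rfl⟩ := hu
      rcases List.sublist_cons_iff.1 hl with h | ⟨r, rfl, h⟩
      · exact ⟨_, prod_mem_sublistSpan x h, 0, zero_mem _, by rw [mul_zero, add_zero]⟩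
      · exact ⟨0, zero_mem _, _, prod_mem_sublistSpan x h, by
          rw [zero_add, List.map_cons, List.prod_cons]⟩
    | zero => exact ⟨0, zero_mem _, 0, zero_mem _, by simp⟩
    | add u u' _ _ h h' =>
      obtain ⟨v, hv, w, hw, rfl⟩ := h
      obtain ⟨v', hv', w', hw', rfl⟩ := h'
      exact ⟨v + v', add_mem hv hv', w + w', add_mem hw hw', by rw [mul_add]; abel⟩
    | smul r u _ h =>
      obtain ⟨v, hv, w, hw, rfl⟩ := h
      exact ⟨r • v, Submodule.smul_mem _ _ hv, r • w, Submodule.smul_mem _ _ hw, by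
        rw [mul_smul_comm, smul_add]⟩
  · rintro ⟨v, hv, w, hw, rfl⟩
    refine add_mem ?_ ?_
    · refine Submodule.span_mono ?_ hv
      rintro _ ⟨l, hl, rfl⟩
      exact ⟨l, hl.trans (List.sublist_cons_self _ _), rfl⟩
    · induction hw using Submodule.span_induction with
      | mem w hw =>
        obtain ⟨l, hl, rfl⟩ := hw
        rw [← List.prod_cons, ← List.map_cons]
        exact prod_mem_sublistSpan x (hl.cons_cons i)
      | zero => rw [mul_zero]; exact zero_mem _
      | add u u' _ _ h h' => rw [mul_add]; exact add_mem h h'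
      | smul r u _ h => rw [mul_smul_comm]; exact Submodule.smul_mem _ _ h

theorem mem_sublistSpan_nil {x : I → A} {u : A} :
    u ∈ sublistSpan R x [] ↔ ∃ r : R, r • 1 = u := by
  have : {w | ∃ l : List I, l.Sublist [] ∧ w = (l.map x).prod} = {1} := by
    ext w
    simp
  rw [sublistSpan, this, Submodule.mem_span_singleton]

/-- If the `x i` anticommute and square to zero, then the span of the ordered products over
sublists of `t` is closed under multiplication by the `x i` with `i ∈ t`. -/
theorem mul_mem_sublistSpan {x : I → A} (hsq : ∀ i, x i * x i = 0)
    (hanti : ∀ i j, x i * x j = -(x j * x i)) (t : List I) {i : I} (hi : i ∈ t) {u : A}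
    (hu : u ∈ sublistSpan R x t) : x i * u ∈ sublistSpan R x t := by
  induction t generalizing u with
  | nil => simp at hi
  | cons j t ih =>
    obtain ⟨v, hv, w, hw, rfl⟩ := mem_sublistSpan_cons.1 hu
    rw [mem_sublistSpan_cons]
    rcases List.mem_cons.1 hi with rfl | hi
    · exact ⟨0, zero_mem _, v, hv, by rw [mul_add, ← mul_assoc, hsq, zero_mul, add_zero, zero_add]⟩
    · refine ⟨x i * v, ih hi hv, -(x i * w), neg_mem (ih hi hw), ?_⟩
      rw [mul_add, ← mul_assoc, hanti i j, mul_neg, neg_mul, mul_assoc]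

theorem prod_mem_sublistSpan_of_subset {x : I → A} (hsq : ∀ i, x i * x i = 0)
    (hanti : ∀ i j, x i * x j = -(x j * x i)) (t : List I) (l : List I) (h : ∀ i ∈ l, i ∈ t) :
    (l.map x).prod ∈ sublistSpan R x t := by
  induction l with
  | nil => exact prod_mem_sublistSpan x (List.nil_sublist t)
  | cons i l ih =>
    rw [List.map_cons, List.prod_cons]
    exact mul_mem_sublistSpan hsq hanti t (h i List.mem_cons_self)
      (ih fun j hj => h j (List.mem_cons_of_mem _ hj))

/-- Permuting the factors of a product of anticommuting elements changes at most its sign. -/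
theorem prod_perm_eq_or_eq_neg {x : I → A} (hanti : ∀ i j, x i * x j = -(x j * x i))
    {l l' : List I} (h : l.Perm l') :
    (l.map x).prod = (l'.map x).prod ∨ (l.map x).prod = -(l'.map x).prod := by
  induction h with
  | nil => exact Or.inl rfl
  | cons i _ ih =>
    simp only [List.map_cons, List.prod_cons]
    rcases ih with h | h
    · exact Or.inl (by rw [h])
    · exact Or.inr (by rw [h, mul_neg])
  | swap i j l =>
    right
    simp only [List.map_cons, List.prod_cons]
    rw [← mul_assoc, hanti, neg_mul, mul_assoc]
  | trans _ _ ih ih' =>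
    rcases ih with h | h <;> rcases ih' with h' | h' <;> rw [h, h'] <;> simp

end SublistSpan

section Exterior

variable {R I : Type*} [CommRing R]

theorem gen_mul_self (i : I) : gen R i * gen R i = 0 := ExteriorAlgebra.ι_sq_zero _

theorem gen_anticomm (i j : I) : gen R i * gen R j = -(gen R j * gen R i) :=
  eq_neg_of_add_eq_zero_left (ExteriorAlgebra.ι_add_mul_swap _ _)

variable (R I) in
theorem span_gen_prod_eq_top :
    Submodule.span R (Set.range fun l : List I => (l.map (gen R)).prod) = ⊤ := by
  rw [eq_top_iff]
  rintro u -
  induction u using ExteriorAlgebra.induction with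
  | algebraMap r =>
    rw [Algebra.algebraMap_eq_smul_one]
    exact Submodule.smul_mem _ _ (Submodule.subset_span ⟨[], rfl⟩)
  | ι m =>
    rw [← Finsupp.sum_single m, Finsupp.sum, map_sum]
    refine sum_mem fun i _ => ?_
    have : (Finsupp.single i (m i) : I →₀ R) = m i • Finsupp.single i 1 := by simp
    rw [this, map_smul]
    exact Submodule.smul_mem _ _ (Submodule.subset_span ⟨[i], by simp⟩)
  | add a b ha hb => exact add_mem ha hb
  | mul a b ha hb =>
    have h := Submodule.mul_mem_mul ha hb
    rw [Submodule.span_mul_span] at h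
    refine Submodule.span_mono ?_ h
    rintro _ ⟨_, ⟨l, rfl⟩, _, ⟨m, rfl⟩, rfl⟩
    exact ⟨l ++ m, by simp⟩

theorem mem_sublistSpan_gen [Fintype I] (u : Ext R I) :
    u ∈ sublistSpan R (gen R) (Finset.univ : Finset I).toList := by
  have h : u ∈ Submodule.span R (Set.range fun l : List I => (l.map (gen R)).prod) := by
    rw [span_gen_prod_eq_top]; trivial
  refine Submodule.span_le.2 ?_ h
  rintro _ ⟨l, rfl⟩
  exact prod_mem_sublistSpan_of_subset gen_mul_self gen_anticomm _ l fun i _ => by simp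

/-- The homomorphism from an exterior algebra given by anticommuting elements of square zero. -/
theorem exists_algHom {A : Type*} [Ring A] [Algebra R A] (x : I → A) (hsq : ∀ i, x i * x i = 0)
    (hanti : ∀ i j, x i * x j = -(x j * x i)) :
    ∃ Φ : Ext R I →ₐ[R] A, ∀ i, Φ (gen R i) = x i := by
  have hsq' : ∀ m : I →₀ R,
      Finsupp.linearCombination R x m * Finsupp.linearCombination R x m = 0 := by
    intro m
    induction m using Finsupp.induction_linear with
    | zero => simp
    | add f g hf hg =>
      have hc : ∀ f g : I →₀ R, Finsupp.linearCombination R x f * Finsupp.linearCombination R x g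
          = -(Finsupp.linearCombination R x g * Finsupp.linearCombination R x f) := by
        intro f g
        induction f using Finsupp.induction_linear with
        | zero => simp
        | add f f' hf hf' => rw [map_add, add_mul, hf, hf', mul_add, neg_add]
        | single i r =>
          induction g using Finsupp.induction_linear with
          | zero => simp
          | add f f' hf hf' => rw [map_add, mul_add, hf, hf', add_mul, neg_add]
          | single j s =>
            rw [Finsupp.linearCombination_single, Finsupp.linearCombination_single,
              smul_mul_smul_comm, smul_mul_smul_comm, hanti, smul_neg, mul_comm]
      rw [map_add, mul_add, add_mul, add_mul, hf, hg, hc f g]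
      abel
    | single i r =>
      rw [Finsupp.linearCombination_single, smul_mul_smul_comm, hsq, smul_zero]
  refine ⟨ExteriorAlgebra.lift R ⟨Finsupp.linearCombination R x, hsq'⟩, fun i => ?_⟩
  rw [gen, ExteriorAlgebra.lift_ι_apply, Finsupp.linearCombination_single, one_smul]

/-- A homomorphism from an exterior algebra is injective if on the target there are operators
`C i` that strip the factor `x i` from ordered products, and annihilate the products without this
factor. -/
theorem injective_of_contractions [Fintype I] {A : Type*} [Ring A] [Algebra R A]
    (Φ : Ext R I →ₐ[R] A) (C : I → A →ₗ[R] A)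
    (hC0 : ∀ i (l : List I), i ∉ l → C i (l.map fun j => Φ (gen R j)).prod = 0)
    (hC1 : ∀ i (l : List I), i ∉ l →
      C i (Φ (gen R i) * (l.map fun j => Φ (gen R j)).prod) = (l.map fun j => Φ (gen R j)).prod)
    (hone : ∀ r : R, r • (1 : A) = 0 → r = 0) : Function.Injective Φ := by
  have hprod : ∀ l : List I, Φ (l.map (gen R)).prod = (l.map fun j => Φ (gen R j)).prod :=
    fun l => by rw [map_list_prod, List.map_map]; rfl
  have key : ∀ t : List I, t.Nodup → ∀ u ∈ sublistSpan R (gen R) t, Φ u = 0 → u = 0 := by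
    intro t
    induction t with
    | nil =>
      intro _ u hu h
      obtain ⟨r, rfl⟩ := mem_sublistSpan_nil.1 hu
      rw [map_smul, map_one] at h
      rw [hone r h, zero_smul]
    | cons i t ih =>
      intro ht u hu h
      obtain ⟨hi, ht⟩ := List.nodup_cons.1 ht
      obtain ⟨v, hv, w, hw, rfl⟩ := mem_sublistSpan_cons.1 hu
      have hCv : C i (Φ v) = 0 := by
        clear h hu
        induction hv using Submodule.span_induction with
        | mem v hv =>
          obtain ⟨l, hl, rfl⟩ := hv
          rw [hprod, hC0 i l fun h => hi (hl.subset h)]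
        | zero => simp
        | add a b _ _ ha hb => rw [map_add, map_add, ha, hb, add_zero]
        | smul r a _ ha => rw [map_smul, map_smul, ha, smul_zero]
      have hCw : C i (Φ (gen R i * w)) = Φ w := by
        clear h hu
        induction hw using Submodule.span_induction with
        | mem v hv =>
          obtain ⟨l, hl, rfl⟩ := hv
          rw [map_mul, hprod, hC1 i l fun h => hi (hl.subset h)]
        | zero => simp
        | add a b _ _ ha hb => rw [mul_add, map_add, map_add, map_add, ha, hb]
        | smul r a _ ha => rw [mul_smul_comm, map_smul, map_smul, map_smul, ha]
      have hw0 : w = 0 := by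
        refine ih ht w hw ?_
        have := congrArg (C i) h
        rwa [map_add, map_add, hCv, hCw, zero_add, map_zero] at this
      rw [hw0, mul_zero, add_zero] at h ⊢
      exact ih ht v hv h
  rw [injective_iff_map_eq_zero]
  exact fun u hu => key _ (Finset.nodup_toList _) u (mem_sublistSpan_gen u) hu

end Exterior

section Comparison

open Forms

variable {R L I : Type*} [CommRing R] [LieRing L] [LieAlgebra R L]

theorem eq_zero_of_smul_one_eq_zero {r : R} (h : r • (1 : Forms R L) = 0) : r = 0 := by
  have h1 : (r • (1 : Forms R L)) 0 0 = (0 : Forms R L) 0 0 := by rw [h]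
  rwa [Forms.smul_apply, one_zero_apply, mul_one] at h1

theorem isHomogeneous_prod {δ : I → ℕ} {x : I → Forms R L}
    (hdeg : ∀ i, IsHomogeneous (δ i) (x i)) (l : List I) :
    IsHomogeneous (l.map δ).sum (l.map x).prod := by
  induction l with
  | nil => exact isHomogeneous_one
  | cons i l ih =>
    rw [List.map_cons, List.map_cons, List.sum_cons, List.prod_cons]
    exact (hdeg i).mul ih

/-- A criterion for the cohomology to be an exterior algebra: the generators `x i` are homogeneous
anticommuting cocycles with operators `C i` that detect them, and some projector `π`, homotopic to
the identity on cocycles, retracts the forms onto the subalgebra that the `x i` generate. -/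
theorem exists_cohomology_algEquiv [Fintype I] (δ : I → ℕ) (x : I → Forms R L)
    (hdeg : ∀ i, IsHomogeneous (δ i) (x i)) (hd : ∀ i, d R L (x i) = 0)
    (hsq : ∀ i, x i * x i = 0) (hanti : ∀ i j, x i * x j = -(x j * x i))
    (C : I → Forms R L →ₗ[R] Forms R L)
    (hC0 : ∀ i (l : List I), i ∉ l → C i (l.map x).prod = 0)
    (hC1 : ∀ i (l : List I), i ∉ l → C i (x i * (l.map x).prod) = (l.map x).prod)
    (π : Forms R L →ₗ[R] Forms R L) (hπd : ∀ f, π (d R L f) = d R L (π f))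
    (hπx : ∀ l : List I, π (l.map x).prod = (l.map x).prod)
    (hπr : ∀ f, π f ∈ Submodule.span R (Set.range fun l : List I => (l.map x).prod))
    (hπh : ∀ f ∈ cocycles R L, ∃ g ∈ cochains R L, f - π f = d R L g)
    (hπk : ∀ k f, IsHomogeneous k f → IsHomogeneous k (π f)) :
    ∃ φ : Ext R I ≃ₐ[R] Cohomology R L,
      (∀ k, (extDegree R δ k).map φ.toLinearMap = cohomologyDegree R L k) ∧
      ∀ i, Represents (x i) (φ (gen R i)) := by
  have hx : ∀ i, x i ∈ cocycles R L := fun i => ⟨(hdeg i).mem_cochains, hd i⟩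
  obtain ⟨Ψ, hΨ⟩ := exists_algHom (R := R) (A := cocycles R L) (fun i => ⟨x i, hx i⟩)
    (fun i => Subtype.ext (hsq i)) (fun i j => Subtype.ext (hanti i j))
  let Φ : Ext R I →ₐ[R] Forms R L := (cocycles R L).val.comp Ψ
  have hΦ : ∀ i, Φ (gen R i) = x i := fun i => congrArg Subtype.val (hΨ i)
  have hΦprod : ∀ l : List I, Φ (l.map (gen R)).prod = (l.map x).prod := fun l => by
    rw [map_list_prod, List.map_map]
    congr 1
    exact List.map_congr_left fun i _ => hΦ i
  have hinj : Function.Injective Φ := by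
    refine injective_of_contractions Φ C ?_ ?_ fun r => eq_zero_of_smul_one_eq_zero
    · simpa only [hΦ] using hC0
    · simpa only [hΦ] using hC1
  have hΦπ : ∀ u, π (Φ u) = Φ u := by
    intro u
    have hu : u ∈ Submodule.span R (Set.range fun l : List I => (l.map (gen R)).prod) := by
      rw [span_gen_prod_eq_top]; trivial
    induction hu using Submodule.span_induction with
    | mem u hu =>
      obtain ⟨l, rfl⟩ := hu
      rw [hΦprod, hπx]
    | zero => simp
    | add a b _ _ ha hb => rw [map_add, map_add, ha, hb]
    | smul r a _ ha => rw [map_smul, map_smul, ha]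
  have hrange : ∀ f, ∃ u, Φ u = π f := by
    intro f
    have h : Submodule.span R (Set.range fun l : List I => (l.map x).prod) ≤
        LinearMap.range Φ.toLinearMap := by
      rw [Submodule.span_le]
      rintro _ ⟨l, rfl⟩
      exact ⟨_, hΦprod l⟩
    exact h (hπr f)
  have hdΦ : ∀ u, d R L (Φ u) = 0 := fun u => (Ψ u).2.2
  let q : Ext R I →ₐ[R] Cohomology R L := (Ideal.Quotient.mkₐ R (coboundaries R L)).comp Ψ
  have hq : ∀ (u : Ext R I) (z : cocycles R L), Φ u = π z →
      q u = Ideal.Quotient.mk (coboundaries R L) z := by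
    intro u z hu
    refine Eq.symm ((Ideal.Quotient.mk_eq_mk_iff_sub_mem _ _).2 ?_)
    obtain ⟨g, hg, h⟩ := hπh z z.2
    refine ⟨g, hg, ?_⟩
    rw [← h, ← hu]
    rfl
  have hbij : Function.Bijective q := by
    constructor
    · rw [injective_iff_map_eq_zero]
      intro u hu
      obtain ⟨g, -, hg⟩ := (Ideal.Quotient.eq_zero_iff_mem).1 hu
      refine hinj ?_
      obtain ⟨w, hw⟩ := hrange g
      have h2 : d R L g = Φ u := hg
      rw [map_zero, ← hΦπ u, ← h2, hπd, ← hw, hdΦ]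
    · intro c
      obtain ⟨z, rfl⟩ := Ideal.Quotient.mk_surjective c
      obtain ⟨u, hu⟩ := hrange z
      exact ⟨u, hq u z hu⟩
  refine ⟨AlgEquiv.ofBijective q hbij, fun k => le_antisymm ?_ ?_, fun i => ?_⟩
  · rw [Submodule.map_le_iff_le_comap, extDegree, Submodule.span_le]
    rintro _ ⟨l, rfl, rfl⟩
    refine ⟨Ψ (l.map (gen R)).prod, ?_, rfl⟩
    have h := isHomogeneous_prod hdeg l
    rw [← hΦprod] at h
    exact h
  · rintro _ ⟨z, hz, rfl⟩
    have hcomp : ∀ u, ∃ u' ∈ extDegree R δ k, Φ u' = component R L k (Φ u) := by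
      intro u
      have hu : u ∈ Submodule.span R (Set.range fun l : List I => (l.map (gen R)).prod) := by
        rw [span_gen_prod_eq_top]; trivial
      induction hu using Submodule.span_induction with
      | mem u hu =>
        obtain ⟨l, rfl⟩ := hu
        change ∃ u' ∈ extDegree R δ k, Φ u' = component R L k (Φ (l.map (gen R)).prod)
        have h := isHomogeneous_prod hdeg l
        rw [hΦprod]
        by_cases hl : (l.map δ).sum = k
        · rw [hl] at h
          exact ⟨_, Submodule.subset_span ⟨l, hl, rfl⟩, by rw [h.component_self, hΦprod]⟩
        · exact ⟨0, zero_mem _, by rw [h.component_of_ne hl, map_zero]⟩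
      | zero => exact ⟨0, zero_mem _, by simp⟩
      | add a b _ _ ha hb =>
        obtain ⟨a', ha', ha⟩ := ha
        obtain ⟨b', hb', hb⟩ := hb
        exact ⟨a' + b', add_mem ha' hb', by rw [map_add, map_add, map_add, ha, hb]⟩
      | smul r a _ ha =>
        obtain ⟨a', ha', ha⟩ := ha
        exact ⟨r • a', Submodule.smul_mem _ _ ha', by rw [map_smul, map_smul, map_smul, ha]⟩
    obtain ⟨u, hu⟩ := hrange z
    obtain ⟨u', hu', h⟩ := hcomp u
    rw [hu, (hπk k _ hz).component_self] at h
    exact ⟨u', hu', hq u' z h⟩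
  · exact ⟨hx i, congrArg _ (hΨ i).symm⟩

end Comparison

/-! ### Weights -/

section Weight

variable {P : Type*} [DecidableEq P]

/-- The weight of a list of positions `(i, j)` at `v`: the number of those with `i = v` minus the
number of those with `j = v`. -/
def weight (v : P) (l : List (P × P)) : ℤ :=
  (l.map fun q => (if q.1 = v then 1 else 0) - (if q.2 = v then 1 else 0)).sum

theorem weight_cons (v : P) (q : P × P) (l : List (P × P)) :
    weight v (q :: l) =
      (if q.1 = v then 1 else 0) - (if q.2 = v then 1 else 0) + weight v l := by
  simp [weight]

theorem weight_append (v : P) (l m : List (P × P)) :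
    weight v (l ++ m) = weight v l + weight v m := by
  simp [weight]

theorem weight_perm (v : P) {l m : List (P × P)} (h : l.Perm m) : weight v l = weight v m :=
  (h.map _).sum_eq

theorem weight_map_swap (v : P) (l : List (P × P)) : weight v (l.map Prod.swap) = -weight v l := by
  induction l with
  | nil => simp [weight]
  | cons q l ih => 
    rw [List.map_cons, weight_cons, ih, weight_cons, Prod.fst_swap, Prod.snd_swap]
    ring

variable {k : Type*} [Field k]

variable (k) in
/-- All weights of the list of positions vanish in `k`. -/
def WeightZero (l : List (P × P)) : Prop := ∀ v : P, (weight v l : k) = 0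

theorem weightZero_nil : WeightZero k ([] : List (P × P)) := fun v => by simp [weight]

theorem WeightZero.append {l m : List (P × P)} (hl : WeightZero k l) (hm : WeightZero k m) :
    WeightZero k (l ++ m) := fun v => by
  rw [weight_append, Int.cast_add, hl v, hm v, add_zero]

theorem WeightZero.of_append_left {l m : List (P × P)} (h : WeightZero k (l ++ m))
    (hl : WeightZero k l) : WeightZero k m := fun v => by
  have := h v
  rwa [weight_append, Int.cast_add, hl v, zero_add] at this

theorem WeightZero.flatMap {I : Type*} {b : I → List (P × P)} (hb : ∀ i, WeightZero k (b i))
    (l : List I) : WeightZero k (l.flatMap b) := by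
  induction l with
  | nil => exact weightZero_nil
  | cons i l ih => rw [List.flatMap_cons]; exact (hb i).append ih

theorem weightZero_map_diag (l : List P) : WeightZero k (l.map fun v => (v, v)) := fun u => by
  induction l with
  | nil => simp [weight]
  | cons v l ih => rw [List.map_cons, weight_cons, sub_self, zero_add, ih]

theorem cast_weight_eq_zero {R : Type*} [CommRing R] (ρ : k →+* R) {l : List (P × P)}
    (hl : WeightZero k l) (v : P) : (weight v l : R) = 0 := by
  rw [← map_intCast ρ, hl v, map_zero]

end Weight

/-! ### Exterior products of matrix coordinates -/

open Forms

section Wedge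

attribute [local instance 100] LieRing.ofAssociativeRing

variable (R : Type*) {P : Type*} [CommRing R] [Fintype P] [DecidableEq P] [PartialOrder P]

open Classical in
/-- The matrix unit `e_ij` of the poset-triangular matrices for a pair `q = (i, j)`; it is `0` if
`i ≤ j` fails. -/
noncomputable def matrixUnit (q : P × P) : glPoset R P :=
  ⟨Matrix.single q.1 q.2 (if q.1 ≤ q.2 then 1 else 0), fun i j hij => by
    rw [Matrix.single_apply]
    split_ifs with h h'
    · exact absurd (h.1 ▸ h.2 ▸ h') hij
    · rfl
    · rfl⟩

/-- The exterior product of the coordinate functionals at a list of positions. -/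
def wedge (l : List (P × P)) : Forms R (glPoset R P) := (l.map fun q => entry R q.1 q.2).prod

variable {R}

theorem contr_entry (x : glPoset R P) (i j : P) :
    contr x (entry R i j) = (x : Matrix P P R) i j • 1 :=
  contr_ofDual _ _

theorem contr_matrixUnit_entry_self {q : P × P} (hq : q.1 ≤ q.2) :
    contr (matrixUnit R q) (entry R q.1 q.2) = 1 := by
  rw [contr_entry]
  simp [matrixUnit, hq]

theorem contr_matrixUnit_entry_of_ne {q q' : P × P} (h : q ≠ q') :
    contr (matrixUnit R q) (entry R q'.1 q'.2) = 0 := by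
  have : (matrixUnit R q : Matrix P P R) q'.1 q'.2 = 0 := by
    have h' : ¬ (q.1 = q'.1 ∧ q.2 = q'.2) := fun h' => h (Prod.ext h'.1 h'.2)
    change Matrix.single q.1 q.2 _ q'.1 q'.2 = _
    rw [Matrix.single_apply, if_neg h']
  rw [contr_entry, this, zero_smul]

theorem wedge_nil : wedge R ([] : List (P × P)) = 1 := rfl

theorem wedge_cons (q : P × P) (l : List (P × P)) :
    wedge R (q :: l) = entry R q.1 q.2 * wedge R l := by
  rw [wedge, List.map_cons, List.prod_cons]; rfl

theorem wedge_append (l m : List (P × P)) : wedge R (l ++ m) = wedge R l * wedge R m := by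
  rw [wedge, List.map_append, List.prod_append]; rfl

theorem wedge_flatMap {I : Type*} (b : I → List (P × P)) (l : List I) :
    wedge R (l.flatMap b) = (l.map fun i => wedge R (b i)).prod := by
  induction l with
  | nil => rfl
  | cons i l ih => rw [List.flatMap_cons, wedge_append, List.map_cons, List.prod_cons, ih]

theorem isHomogeneous_wedge (l : List (P × P)) : IsHomogeneous l.length (wedge R l) := by
  induction l with
  | nil => exact isHomogeneous_one
  | cons q l ih =>
    rw [wedge_cons, List.length_cons, add_comm]
    exact (isHomogeneous_ofDual _).mul ih

theorem invol_wedge (l : List (P × P)) : invol (wedge R l) = (-1 : R) ^ l.length • wedge R l := by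
  induction l with
  | nil => rw [wedge_nil, invol_one, List.length_nil, pow_zero, one_smul]
  | cons q l ih =>
    rw [wedge_cons, invol_mul, ih, entry, invol_ofDual, List.length_cons, pow_succ, mul_neg_one,
      neg_smul, mul_smul_comm, neg_mul, smul_neg]

theorem entry_anticomm (i j k l : P) :
    entry R i j * entry R k l = -(entry R k l * entry R i j) := by
  unfold entry
  rw [Forms.ofDual_mul, invol_ofDual, neg_mul]

theorem wedge_mul_wedge (l m : List (P × P)) :
    wedge R l * wedge R m = (-1 : R) ^ (l.length * m.length) • (wedge R m * wedge R l) := by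
  induction l with
  | nil => simp [wedge_nil]
  | cons q l ih =>
    rw [wedge_cons, mul_assoc, ih, mul_smul_comm, ← mul_assoc, entry, Forms.ofDual_mul, invol_wedge,
      smul_mul_assoc, smul_mul_assoc, smul_smul, mul_assoc, List.length_cons, add_mul, one_mul,
      pow_add]

theorem wedge_mul_self {l : List (P × P)} (hl : l ≠ []) : wedge R l * wedge R l = 0 := by
  obtain ⟨q, l, rfl⟩ := List.exists_cons_of_ne_nil hl
  rw [wedge_cons, mul_assoc, ← mul_assoc (wedge R l), entry, ← invol_invol (wedge R l),
    ← Forms.ofDual_mul, mul_assoc, ← mul_assoc, ofDual_mul_self, zero_mul]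

/-- Contraction with a matrix unit whose position is not listed kills the exterior product. -/
theorem contr_wedge_of_notMem {q : P × P} {l : List (P × P)} (h : q ∉ l) :
    contr (matrixUnit R q) (wedge R l) = 0 := by
  induction l with
  | nil => rfl
  | cons q' l ih =>
    obtain ⟨h1, h2⟩ := not_or.1 fun h' => h (List.mem_cons.2 h')
    rw [wedge_cons, contr_mul, ih h2, contr_matrixUnit_entry_of_ne h1, zero_mul, mul_zero, add_zero]

theorem contr_entry_mul {q : P × P} (hq : q.1 ≤ q.2) {f : Forms R (glPoset R P)}
    (hf : contr (matrixUnit R q) f = 0) :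
    contr (matrixUnit R q) (entry R q.1 q.2 * f) = f := by
  rw [contr_mul, hf, contr_matrixUnit_entry_self hq, one_mul, mul_zero, add_zero]

variable (R) in
/-- The iterated contraction with the matrix units at a list of positions, the first one first. -/
noncomputable def contrList : List (P × P) → Module.End R (Forms R (glPoset R P))
  | [] => 1
  | q :: l => contrList l * contrLin (matrixUnit R q)

theorem contrList_cons_apply (q : P × P) (l : List (P × P)) (f : Forms R (glPoset R P)) :
    contrList R (q :: l) f = contrList R l (contr (matrixUnit R q) f) := rfl

theorem contrList_wedge_mul_wedge {l m : List (P × P)} (hl : l.Nodup) (hle : ∀ q ∈ l, q.1 ≤ q.2)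
    (hlm : ∀ q ∈ l, q ∉ m) : contrList R l (wedge R l * wedge R m) = wedge R m := by
  induction l with
  | nil => rw [wedge_nil, one_mul]; rfl
  | cons q l ih =>
    obtain ⟨hq, hl⟩ := List.nodup_cons.1 hl
    rw [contrList_cons_apply, wedge_cons, mul_assoc, contr_entry_mul (hle q List.mem_cons_self),
      ih hl (fun q hq => hle q (List.mem_cons_of_mem _ hq))
        fun q hq => hlm q (List.mem_cons_of_mem _ hq)]
    rw [← wedge_append]
    refine contr_wedge_of_notMem fun h => ?_
    rcases List.mem_append.1 h with h | h
    · exact hq h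
    · exact hlm q List.mem_cons_self h

theorem contrList_wedge_eq_zero {l m : List (P × P)} (hl : l ≠ []) (hlm : ∀ q ∈ l, q ∉ m) :
    contrList R l (wedge R m) = 0 := by
  obtain ⟨q, l, rfl⟩ := List.exists_cons_of_ne_nil hl
  rw [contrList_cons_apply, contr_wedge_of_notMem (hlm q List.mem_cons_self), map_zero]

theorem matrixUnit_eq_zero {q : P × P} (hq : ¬ q.1 ≤ q.2) : matrixUnit R q = 0 := by
  refine Subtype.ext ?_
  simp [matrixUnit, hq]

theorem contr_zero_left (f : Forms R (glPoset R P)) : contr (0 : glPoset R P) f = 0 := by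
  simpa using contr_smul_left (0 : R) (0 : glPoset R P) f

theorem eq_sum_matrixUnit (x : glPoset R P) :
    x = ∑ q : P × P, (x : Matrix P P R) q.1 q.2 • matrixUnit R q := by
  refine Subtype.ext (Matrix.ext fun i j => ?_)
  have h : ((∑ q : P × P, (x : Matrix P P R) q.1 q.2 • matrixUnit R q : glPoset R P) :
      Matrix P P R) = ∑ q : P × P, (x : Matrix P P R) q.1 q.2 • (matrixUnit R q : Matrix P P R) := by
    rw [← LieSubalgebra.coe_incl, map_sum]
    rfl
  rw [h, Matrix.sum_apply, Finset.sum_eq_single (i, j)]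
  · by_cases hij : i ≤ j
    · simp [matrixUnit, hij]
    · simp [matrixUnit, hij, x.2 i j hij]
  · intro q _ hq
    have h' : ¬ (q.1 = i ∧ q.2 = j) := fun h' => hq (Prod.ext h'.1 h'.2)
    change (x : Matrix P P R) q.1 q.2 * Matrix.single q.1 q.2 _ i j = _
    rw [Matrix.single_apply, if_neg h', mul_zero]
  · simp

/-- A form that is killed by the contractions with all matrix units outside a list of positions is
a combination of exterior products of coordinate functionals at these positions. The functionals
are split off one by one: `f = θ ∧ f' + f''`, where `f'` is the contraction of `f` and `f''` is
killed by the contraction. -/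
theorem mem_sublistSpan_of_contr_eq_zero (l : List (P × P)) (hle : ∀ q ∈ l, q.1 ≤ q.2)
    {f : Forms R (glPoset R P)} (hf : ∀ q, q ∉ l → contr (matrixUnit R q) f = 0) :
    f ∈ sublistSpan R (fun q : P × P => entry R q.1 q.2) l := by
  induction l generalizing f with
  | nil =>
    rw [mem_sublistSpan_nil]
    refine ⟨f 0 0, ext_contr (fun v => ?_) fun x => ?_⟩
    · rw [Forms.smul_apply, one_zero_apply, mul_one, Subsingleton.elim v 0]
    · rw [contr_smul, contr_one, smul_zero, eq_sum_matrixUnit x]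
      have h : ∀ s : Finset (P × P),
          contr (∑ q ∈ s, (x : Matrix P P R) q.1 q.2 • matrixUnit R q) f = 0 := by
        intro s
        induction s using Finset.induction_on with
        | empty => exact contr_zero_left f
        | insert q s hq ih =>
          rw [Finset.sum_insert hq, contr_add_left, ih, contr_smul_left, hf q List.not_mem_nil,
            smul_zero, add_zero]
      exact (h _).symm
  | cons q l ih =>
    have hle' : ∀ q ∈ l, q.1 ≤ q.2 := fun q hq => hle q (List.mem_cons_of_mem _ hq)
    have hself := contr_self (matrixUnit R q) f
    have hq1 := contr_entry_mul (hle q List.mem_cons_self) hself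
    have hcomm : ∀ q', q' ≠ q → q' ∉ l →
        contr (matrixUnit R q') (contr (matrixUnit R q) f) = 0 := fun q' h1 h2 => by
      rw [contr_comm, hf q' (by simp [h1, h2])]
      change -(0 : Forms R (glPoset R P)) = 0
      rw [neg_zero]
    rw [mem_sublistSpan_cons]
    refine ⟨f - entry R q.1 q.2 * contr (matrixUnit R q) f, ih hle' fun q' hq' => ?_,
      contr (matrixUnit R q) f, ih hle' fun q' hq' => ?_, by abel⟩
    · by_cases h : q' = q
      · rw [h, contr_sub, hq1, sub_self]
      · rw [contr_sub, hf q' (by simp [h, hq']), contr_mul, hcomm q' h hq',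
          contr_matrixUnit_entry_of_ne h, zero_mul, mul_zero, add_zero, sub_zero]
    · by_cases h : q' = q
      · rw [h, hself]
      · exact hcomm q' h hq'

theorem lieDer_entry (v i j : P) : lieDer (matrixUnit R (v, v)) (entry R i j) =
    -(((if i = v then 1 else 0) - (if j = v then 1 else 0) : ℤ) : R) • entry R i j := by
  have h : ∀ y : glPoset R P, ((⁅matrixUnit R (v, v), y⁆ : glPoset R P) : Matrix P P R) i j =
      (((if i = v then 1 else 0) - (if j = v then 1 else 0) : ℤ) : R) * (y : Matrix P P R) i j := by
    intro y
    have h1 : (matrixUnit R (v, v) : Matrix P P R) = Matrix.single v v 1 := by simp [matrixUnit]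
    rw [LieSubalgebra.coe_bracket, Ring.lie_def, h1, Matrix.sub_apply]
    by_cases hi : i = v <;> by_cases hj : j = v <;> simp [hi, hj]
  rw [entry, lieDer_ofDual, neg_smul]
  congr 1
  refine ext_contr (fun w => by simp [ofDual_zero_apply]) fun y => ?_
  rw [contr_smul, contr_ofDual, contr_ofDual, smul_smul]
  congr 1
  exact h y

theorem lieDer_wedge (v : P) (l : List (P × P)) :
    lieDer (matrixUnit R (v, v)) (wedge R l) = -(weight v l : R) • wedge R l := by
  induction l with
  | nil =>
    have h := lieDer_mul (matrixUnit R (v, v)) (1 : Forms R (glPoset R P)) 1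
    rw [mul_one, mul_one, one_mul] at h
    rw [wedge_nil, left_eq_add.1 h]
    simp [weight]
  | cons q l ih =>
    rw [wedge_cons, lieDer_mul, ih, lieDer_entry, weight_cons, smul_mul_assoc, mul_smul_comm,
      ← add_smul, Int.cast_add _ (weight v l), neg_add]

/-- The diagonal coordinates are cocycles. -/
theorem d_entry_self (i : P) : d R (glPoset R P) (entry R i i) = 0 := by
  refine ext_contr (fun v => rfl) fun x => ?_
  have h1 : d R (glPoset R P) (contr x (entry R i i)) = 0 := by
    rw [contr_entry, map_smul, d_one, smul_zero]
  rw [contr_d, h1, sub_zero, entry, lieDer_ofDual]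
  have h2 : (((Matrix.entryLinearMap R R i i).comp (glPoset R P).toSubmodule.subtype).comp
      (LieAlgebra.ad R (glPoset R P) x : glPoset R P →ₗ[R] glPoset R P)) = 0 := by
    refine LinearMap.ext fun y => ?_
    change (⁅(x : Matrix P P R), (y : Matrix P P R)⁆) i i = 0
    have h3 : ∀ x y : glPoset R P, ((x : Matrix P P R) * (y : Matrix P P R)) i i =
        (x : Matrix P P R) i i * (y : Matrix P P R) i i := by
      intro x y
      rw [Matrix.mul_apply]
      refine Finset.sum_eq_single i (fun k _ hk => ?_) (by simp)
      by_cases h : i ≤ k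
      · rw [y.2 k i fun h' => hk (le_antisymm h' h), mul_zero]
      · rw [x.2 i k h, zero_mul]
    rw [Ring.lie_def, Matrix.sub_apply, h3, h3, mul_comm, sub_self]
  rw [h2]
  refine ext_contr (fun v => neg_zero) fun y => ?_
  rw [contr_neg, contr_ofDual, LinearMap.zero_apply, zero_smul, neg_zero]
  rfl

end Wedge

/-! ### The part of weight zero -/

section WeightFilter

variable {R P : Type*} [CommRing R] [Fintype P] [DecidableEq P] [PartialOrder P]
variable {k : Type*} [Field k]

/-- A product of operators `1 + c • (Lie derivative along e_vv)` that fixes the exterior products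
of weight zero, and kills those of nonzero weight over sublists of `l₀`. There is one factor for
each vertex `v` and each sublist of `l₀`; where the weight of the sublist at `v` vanishes in `k`,
then `c = 0⁻¹ = 0` and the factor is the identity. -/
noncomputable def weightFilter (ρ : k →+* R) (l₀ : List (P × P)) :
    Module.End R (Forms R (glPoset R P)) :=
  filterOp ((l₀.sublists ×ˢ (Finset.univ : Finset P).toList).map fun t =>
    (matrixUnit R (t.2, t.2), ρ (weight t.2 t.1 : k)⁻¹))

theorem lieDer_wedge_of_weightZero (ρ : k →+* R) {l : List (P × P)} (hl : WeightZero k l) (v : P) :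
    lieDer (matrixUnit R (v, v)) (wedge R l) = 0 := by
  rw [lieDer_wedge, cast_weight_eq_zero ρ hl, neg_zero, zero_smul]

theorem weightFilter_wedge_of_weightZero (ρ : k →+* R) (l₀ : List (P × P)) {l : List (P × P)}
    (hl : WeightZero k l) : weightFilter ρ l₀ (wedge R l) = wedge R l := by
  refine filterOp_eq_self _ fun t ht => ?_
  obtain ⟨⟨m, v⟩, -, rfl⟩ := List.mem_map.1 ht
  exact lieDer_wedge_of_weightZero ρ hl v

theorem weightFilter_wedge_of_not_weightZero (ρ : k →+* R) {l₀ l : List (P × P)}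
    (h : l.Sublist l₀) (hl : ¬ WeightZero k l) : weightFilter ρ l₀ (wedge R l) = 0 := by
  obtain ⟨v, hv⟩ := not_forall.1 hl
  refine filterOp_eq_zero _ (fun t ht => ?_)
    (t := (matrixUnit R (v, v), ρ (weight v l : k)⁻¹)) ?_ ?_
  · obtain ⟨⟨m, u⟩, -, rfl⟩ := List.mem_map.1 ht
    exact ⟨_, lieDer_wedge u l⟩
  · exact List.mem_map.2 ⟨(l, v), List.mem_product.2 ⟨List.mem_sublists.2 h, by simp⟩, rfl⟩
  · rw [lieDer_wedge, smul_smul, ← map_intCast ρ, mul_neg, ← map_mul, inv_mul_cancel₀ hv, map_one,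
      neg_smul, one_smul, add_neg_cancel]

theorem weightFilter_mem_span (ρ : k →+* R) (l₀ : List (P × P)) {f : Forms R (glPoset R P)}
    (hf : f ∈ sublistSpan R (fun q : P × P => entry R q.1 q.2) l₀) :
    weightFilter ρ l₀ f ∈
      Submodule.span R {w | ∃ l : List (P × P), l.Sublist l₀ ∧ WeightZero k l ∧ w = wedge R l} := by
  induction hf using Submodule.span_induction with
  | mem f hf =>
    obtain ⟨l, hl, rfl⟩ := hf
    change weightFilter ρ l₀ (wedge R l) ∈ _
    by_cases h : WeightZero k l
    · rw [weightFilter_wedge_of_weightZero ρ l₀ h]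
      exact Submodule.subset_span ⟨l, hl, h, rfl⟩
    · rw [weightFilter_wedge_of_not_weightZero ρ hl h]
      exact zero_mem _
  | zero => rw [map_zero]; exact zero_mem _
  | add f g _ _ hf hg => rw [map_add]; exact add_mem hf hg
  | smul r f _ hf => rw [map_smul]; exact Submodule.smul_mem _ _ hf

/-- The cohomology is an exterior algebra on generators that are exterior products of coordinates,
provided that these generators involve disjoint sets of coordinates and that the exterior products
of weight zero are generated by them. -/
theorem exists_cohomology_algEquiv_of_blocks (ρ : k →+* R) {I : Type*} [Fintype I]
    (b : I → List (P × P)) (hne : ∀ i, b i ≠ []) (hnodup : ∀ i, (b i).Nodup)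
    (hle : ∀ i, ∀ q ∈ b i, q.1 ≤ q.2) (hdisj : ∀ i j, i ≠ j → ∀ q ∈ b i, q ∉ b j)
    (hodd : ∀ i, Odd (b i).length) (hwt : ∀ i, WeightZero k (b i))
    (hd : ∀ i, d R (glPoset R P) (wedge R (b i)) = 0)
    (l₀ : List (P × P)) (hl₀ : ∀ q : P × P, q ∈ l₀ ↔ q.1 ≤ q.2)
    (hspan : ∀ l : List (P × P), l.Sublist l₀ → WeightZero k l → wedge R l ∈
      Submodule.span R (Set.range fun m : List I => (m.map fun i => wedge R (b i)).prod)) :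
    ∃ φ : Ext R I ≃ₐ[R] Cohomology R (glPoset R P),
      (∀ n, (extDegree R (fun i => (b i).length) n).map φ.toLinearMap =
        cohomologyDegree R (glPoset R P) n) ∧
      ∀ i, Represents (wedge R (b i)) (φ (gen R i)) := by
  have hnotMem : ∀ i (l : List I), i ∉ l → ∀ q ∈ b i, q ∉ l.flatMap b := by
    intro i l hi q hq h
    obtain ⟨j, hj, hqj⟩ := List.mem_flatMap.1 h
    exact hdisj i j (fun h => hi (h ▸ hj)) q hq hqj
  refine exists_cohomology_algEquiv (fun i => (b i).length) (fun i => wedge R (b i))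
    (fun i => isHomogeneous_wedge _) hd (fun i => wedge_mul_self (hne i)) (fun i j => ?_)
    (fun i => contrList R (b i)) (fun i l hi => ?_) (fun i l hi => ?_) (weightFilter ρ l₀)
    (fun f => filterOp_d _ f) (fun l => ?_) (fun f => ?_)
    (fun f hf => (exists_sub_filterOp_eq_d _ hf).2) (fun n f hf => hf.filterOp _)
  · rw [wedge_mul_wedge, Odd.neg_one_pow ((hodd i).mul (hodd j)), neg_one_smul]
  · rw [← wedge_flatMap]
    exact contrList_wedge_eq_zero (hne i) (hnotMem i l hi)
  · rw [← wedge_flatMap]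
    exact contrList_wedge_mul_wedge (hnodup i) (hle i) (hnotMem i l hi)
  · rw [← wedge_flatMap]
    exact weightFilter_wedge_of_weightZero ρ l₀ (WeightZero.flatMap hwt l)
  · have hf : f ∈ sublistSpan R (fun q : P × P => entry R q.1 q.2) l₀ :=
      mem_sublistSpan_of_contr_eq_zero l₀ (fun q hq => (hl₀ q).1 hq) fun q hq => by
        rw [matrixUnit_eq_zero fun h => hq ((hl₀ q).2 h), contr_zero_left]
    refine Submodule.span_le.2 ?_ (weightFilter_mem_span ρ l₀ hf)
    rintro _ ⟨l, hl, hwl, rfl⟩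
    exact hspan l hl hwl

end WeightFilter

/-! ### Balanced sets of relations -/

section Balanced

variable {P : Type*}

/-- The relations `a < b`, `a < x` and `x < b`, where `x` runs through `t`. -/
def diamond (a b : P) (t : List P) : List (P × P) :=
  (a, b) :: t.flatMap fun x => [(a, x), (x, b)]

theorem mem_diamond {a b : P} {t : List P} {q : P × P} :
    q ∈ diamond a b t ↔ q = (a, b) ∨ ∃ x ∈ t, q = (a, x) ∨ q = (x, b) := by
  simp [diamond]

theorem nodup_diamond {a b : P} {t : List P} (ht : t.Nodup) (ha : a ∉ t) (hb : b ∉ t) :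
    (diamond a b t).Nodup := by
  rw [diamond, List.nodup_cons]
  constructor
  · simp only [List.mem_flatMap, List.mem_cons, Prod.mk.injEq, List.not_mem_nil, or_false,
      not_exists, not_and]
    rintro x hx (⟨-, rfl⟩ | ⟨rfl, -⟩)
    · exact hb hx
    · exact ha hx
  · refine List.nodup_flatMap.2 ⟨fun x hx => ?_, ht.imp_of_mem fun {x y} hx hy hxy => ?_⟩
    · have : a ≠ x := fun h => ha (h ▸ hx)
      simp [this]
    · simp only [Function.onFun, List.disjoint_cons_left, List.mem_cons, Prod.mk.injEq,
        List.not_mem_nil, or_false, List.disjoint_nil_left, and_true, not_or, true_and]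
      refine ⟨⟨hxy, ?_⟩, ?_, hxy⟩
      · rintro ⟨rfl, -⟩
        exact ha hy
      · rintro ⟨rfl, -⟩
        exact ha hx

theorem length_diamond (a b : P) (t : List P) : (diamond a b t).length = 2 * t.length + 1 := by
  induction t with
  | nil => rfl
  | cons x t ih =>
    simp only [diamond, List.flatMap_cons, List.length_cons, List.length_append,
      List.length_nil] at ih ⊢
    omega

variable [DecidableEq P]

theorem weight_diamond (v a b : P) (t : List P) : weight v (diamond a b t) =
    (t.length + 1) * ((if a = v then 1 else 0) - (if b = v then 1 else 0)) := by
  have h : weight v (t.flatMap fun x => [(a, x), (x, b)]) =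
      t.length * ((if a = v then 1 else 0) - (if b = v then 1 else 0)) := by
    induction t with
    | nil => simp [weight]
    | cons x t ih =>
      rw [List.flatMap_cons, weight_append, ih, weight_cons, weight_cons, List.length_cons]
      push_cast
      simp only [weight, List.map_nil, List.sum_nil]
      ring
  rw [diamond, weight_cons, h]
  ring

variable [Fintype P]

/-- In a nonempty acyclic set `l` of arrows, a minimal source has positive weight, which is less
than the number of vertices; if it is as large as possible, then this source is joined to all other
vertices. -/
theorem exists_weight_eq_of_ne_nil (r : P → P → Prop) [IsTrans P r] [Std.Irrefl r]
    {l : List (P × P)} (hl : l.Nodup) (hne : l ≠ []) (hr : ∀ q ∈ l, r q.1 q.2) :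
    ∃ (v : P) (m : ℕ), weight v l = m ∧ 0 < m ∧ m + 1 ≤ Fintype.card P ∧
      (m + 1 = Fintype.card P → ∀ j, j ≠ v → (v, j) ∈ l) := by
  have hwf : WellFounded r := Finite.wellFounded_of_trans_of_irrefl r
  obtain ⟨q₀, hq₀⟩ := List.exists_mem_of_ne_nil l hne
  obtain ⟨v, ⟨j₀, hj₀⟩, hmin⟩ := hwf.has_min {u | ∃ j, (u, j) ∈ l} ⟨q₀.1, q₀.2, hq₀⟩
  have hin : ∀ q ∈ l, q.2 ≠ v := fun q hq h => hmin q.1 ⟨q.2, hq⟩ (h ▸ hr q hq)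
  let T : Finset P := Finset.univ.filter fun j => (v, j) ∈ l
  have hT : T ⊆ Finset.univ.erase v := fun j hj =>
    Finset.mem_erase.2 ⟨hin (v, j) (Finset.mem_filter.1 hj).2, Finset.mem_univ j⟩
  have hcard : (Finset.univ.erase v : Finset P).card + 1 = Fintype.card P :=
    Finset.card_erase_add_one (Finset.mem_univ v)
  refine ⟨v, T.card, ?_, Finset.card_pos.2 ⟨j₀, by simpa [T] using hj₀⟩, ?_, fun h j hj => ?_⟩
  · have h1 : weight v l = ((l.toFinset.filter fun q => q.1 = v).card : ℤ) := by
      rw [weight, ← List.sum_toFinset _ hl, Finset.card_filter, Nat.cast_sum]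
      refine Finset.sum_congr rfl fun q hq => ?_
      rw [if_neg (hin q (List.mem_toFinset.1 hq))]
      split_ifs <;> rfl
    have h2 : (l.toFinset.filter fun q => q.1 = v) = T.image fun j => (v, j) := by
      ext ⟨i, j⟩
      simp only [T, Finset.mem_filter, List.mem_toFinset, Finset.mem_image, Finset.mem_univ,
        true_and, Prod.mk.injEq]
      constructor
      · rintro ⟨h, rfl⟩
        exact ⟨j, h, rfl, rfl⟩
      · rintro ⟨j, h, rfl, rfl⟩
        exact ⟨h, rfl⟩
    rw [h1, h2, Finset.card_image_of_injective _ fun i j h => congrArg Prod.snd h]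
  · rw [← hcard]
    exact Nat.succ_le_succ (Finset.card_le_card hT)
  · have hTeq : T = Finset.univ.erase v := Finset.eq_of_subset_of_card_le hT (by omega)
    have : j ∈ T := hTeq ▸ Finset.mem_erase.2 ⟨hj, Finset.mem_univ j⟩
    exact (Finset.mem_filter.1 this).2

variable [PartialOrder P] {k : Type*} [Field k]

theorem eq_nil_of_weightZero (hk : ∀ m : ℕ, 0 < m → m + 1 ≤ Fintype.card P → (m : k) ≠ 0)
    {l : List (P × P)} (hl : l.Nodup) (hlt : ∀ q ∈ l, q.1 < q.2) (hw : WeightZero k l) :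
    l = [] := by
  by_contra hne
  obtain ⟨v, m, hm, h0, hc, -⟩ := exists_weight_eq_of_ne_nil (· < ·) hl hne hlt
  refine hk m h0 hc ?_
  have := hw v
  rwa [hm, Int.cast_natCast] at this

theorem exists_bot_top_of_weightZero
    (hk : ∀ m : ℕ, 0 < m → m + 1 < Fintype.card P → (m : k) ≠ 0)
    {l : List (P × P)} (hl : l.Nodup) (hne : l ≠ []) (hlt : ∀ q ∈ l, q.1 < q.2)
    (hw : WeightZero k l) :
    ∃ a b : P, (∀ j, j ≠ a → (a, j) ∈ l) ∧ (∀ j, j ≠ b → (j, b) ∈ l) := by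
  obtain ⟨a, m, hm, h0, hc, ha⟩ := exists_weight_eq_of_ne_nil (· < ·) hl hne hlt
  obtain ⟨b, m', hm', h0', hc', hb⟩ := exists_weight_eq_of_ne_nil (Function.swap (· < ·))
    (hl.map Prod.swap_injective) (by simpa using hne) (l := l.map Prod.swap)
    (fun q hq => by
      obtain ⟨q', hq', rfl⟩ := List.mem_map.1 hq
      exact hlt q' hq')
  refine ⟨a, b, ha ?_, fun j hj => ?_⟩
  · by_contra h
    refine hk m h0 (by omega) ?_
    have := hw a
    rwa [hm, Int.cast_natCast] at this
  · have h := hb ?_ j hj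
    · obtain ⟨q, hq, h⟩ := List.mem_map.1 h
      rwa [Prod.swap_eq_iff_eq_swap.1 h] at hq
    · by_contra h
      refine hk m' h0' (by omega) ?_
      have := hw b
      rw [weight_map_swap] at hm'
      rw [← Int.cast_natCast, ← hm', Int.cast_neg, this, neg_zero]

/-- The only nonempty balanced set of relations is the full diamond. After a balanced diamond is
removed, the rest is balanced; were it nonempty, it would contain `a < b` again. -/
theorem perm_diamond_of_weightZero
    (hk : ∀ m : ℕ, 0 < m → m + 1 < Fintype.card P → (m : k) ≠ 0) {a b : P} (ha : IsBot a)
    (hb : IsTop b) (hab : a ≠ b) {t : List P} (ht : t.Nodup) (hmem : ∀ x, x ∈ t ↔ x ≠ a ∧ x ≠ b)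
    (hD : WeightZero k (diamond a b t)) {l : List (P × P)} (hl : l.Nodup) (hne : l ≠ [])
    (hlt : ∀ q ∈ l, q.1 < q.2) (hw : WeightZero k l) : l.Perm (diamond a b t) := by
  have key : ∀ l : List (P × P), l.Nodup → l ≠ [] → (∀ q ∈ l, q.1 < q.2) → WeightZero k l →
      (∀ j, j ≠ a → (a, j) ∈ l) ∧ (∀ j, j ≠ b → (j, b) ∈ l) := by
    intro l hl hne hlt hw
    obtain ⟨a', b', ha', hb'⟩ := exists_bot_top_of_weightZero hk hl hne hlt hw
    have haa : a' = a := by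
      by_contra h
      exact (hlt _ (ha' a (Ne.symm h))).not_ge (ha a')
    have hbb : b' = b := by
      by_contra h
      exact (hlt _ (hb' b (Ne.symm h))).not_ge (hb b')
    rw [← haa, ← hbb]
    exact ⟨ha', hb'⟩
  obtain ⟨h1, h2⟩ := key l hl hne hlt hw
  have hta : a ∉ t := fun h => ((hmem a).1 h).1 rfl
  have htb : b ∉ t := fun h => ((hmem b).1 h).2 rfl
  have hsub : (diamond a b t).Subperm l := by
    refine List.subperm_of_subset (nodup_diamond ht hta htb) fun q hq => ?_
    rcases mem_diamond.1 hq with rfl | ⟨x, hx, rfl | rfl⟩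
    · exact h1 b (Ne.symm hab)
    · exact h1 x ((hmem x).1 hx).1
    · exact h2 x ((hmem x).1 hx).2
  obtain ⟨l', hl', hsub⟩ := hsub
  obtain ⟨m, hm⟩ := hsub.exists_perm_append
  replace hm := hm.trans (hl'.append_right m)
  have hnd := hm.nodup_iff.1 hl
  have hm0 : m = [] := by
    by_contra hne'
    have hwm : WeightZero k (diamond a b t ++ m) := fun v => by rw [← weight_perm v hm]; exact hw v
    have h3 := (key m (List.nodup_append.1 hnd).2.1 hne'
      (fun q hq => hlt q (hm.symm.subset (List.mem_append_right _ hq)))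
      (hwm.of_append_left hD)).1 b (Ne.symm hab)
    exact (List.nodup_append.1 hnd).2.2 _ (mem_diamond.2 (Or.inl rfl)) _ h3 rfl
  rwa [hm0, List.append_nil] at hm

end Balanced

/-! ### The cohomology in terms of balanced sets of relations -/

section Assembly

variable {R P : Type*} [CommRing R] [Fintype P] [PartialOrder P]
variable {k : Type*} [Field k]

open Classical in
variable (P) in
/-- The pairs `(i, j)` with `i < j`, listed in some order. -/
noncomputable def ltPairs : List (P × P) :=
  ((Finset.univ : Finset (P × P)).filter fun q => q.1 < q.2).toList

variable (P) in
/-- The pairs `(i, j)` with `i ≤ j`, the diagonal ones first. -/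
noncomputable def lePairs : List (P × P) :=
  (Finset.univ : Finset P).toList.map (fun v => (v, v)) ++ ltPairs P

theorem mem_ltPairs {q : P × P} : q ∈ ltPairs P ↔ q.1 < q.2 := by simp [ltPairs]

theorem nodup_ltPairs : (ltPairs P).Nodup := Finset.nodup_toList _

theorem mem_lePairs {q : P × P} : q ∈ lePairs P ↔ q.1 ≤ q.2 := by
  rw [lePairs, List.mem_append, mem_ltPairs, le_iff_eq_or_lt]
  refine or_congr_left ?_
  simp only [List.mem_map, Finset.mem_toList, Finset.mem_univ, true_and]
  exact ⟨fun ⟨v, hv⟩ => hv ▸ rfl, fun h => ⟨q.1, Prod.ext rfl h⟩⟩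

variable [DecidableEq P]

/-- A list of weight zero consists of diagonal pairs and of a list of strict relations of weight
zero. -/
theorem exists_eq_diag_append {l : List (P × P)} (hl : l.Sublist (lePairs P))
    (hw : WeightZero k l) : ∃ (s : List P) (m : List (P × P)), l = s.map (fun v => (v, v)) ++ m ∧
      m.Nodup ∧ (∀ q ∈ m, q.1 < q.2) ∧ WeightZero k m := by
  obtain ⟨l₁, m, rfl, h1, h2⟩ := List.sublist_append_iff.1 hl
  obtain ⟨s, -, rfl⟩ := List.sublist_map_iff.1 h1
  exact ⟨s, m, rfl, h2.nodup nodup_ltPairs, fun q hq => mem_ltPairs.1 (h2.subset hq),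
    hw.of_append_left (weightZero_map_diag s)⟩

theorem wedge_map_diag (s : List P) :
    wedge R (s.map fun v => (v, v)) = (s.map fun v => wedge R [(v, v)]).prod := by
  rw [← wedge_flatMap, List.map_eq_flatMap]

theorem wedge_singleton (q : P × P) : wedge R [q] = entry R q.1 q.2 := by
  rw [wedge_cons, wedge_nil, mul_one]

/-- If no nonempty set of strict relations is balanced, then the cohomology is generated by the
diagonal coordinates. -/
theorem exists_algEquiv_of_forall_eq_nil (ρ : k →+* R)
    (h : ∀ l : List (P × P), l.Nodup → (∀ q ∈ l, q.1 < q.2) → WeightZero k l → l = []) :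
    ∃ φ : Ext R P ≃ₐ[R] Cohomology R (glPoset R P),
      (∀ n, (extDegree R (fun _ : P => 1) n).map φ.toLinearMap =
        cohomologyDegree R (glPoset R P) n) ∧
      ∀ i, Represents (entry R i i) (φ (gen R i)) := by
  obtain ⟨φ, h1, h2⟩ := exists_cohomology_algEquiv_of_blocks (R := R) ρ (fun v : P => [(v, v)])
    (by simp) (by simp) (by simp) (by simp +contextual) (by simp) (fun v => weightZero_map_diag [v])
    (fun v => by rw [wedge_singleton, d_entry_self]) (lePairs P) (fun q => mem_lePairs)
    (fun l hl hw => by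
      obtain ⟨s, m, rfl, h1, h2, h3⟩ := exists_eq_diag_append hl hw
      rw [h m h1 h2 h3, List.append_nil, wedge_map_diag]
      exact Submodule.subset_span ⟨s, rfl⟩)
  simp only [wedge_singleton] at h2
  exact ⟨φ, h1, h2⟩

/-- An exterior product of strict coordinates of weight zero is a cocycle, if up to the order of
the factors it is the only one of positive degree. For its differential is killed by the
contractions with all `e_vv` and has weight zero. Hence it is a combination of exterior products of
strict coordinates of weight zero, and there are none in its degree. -/
theorem d_wedge_eq_zero (ρ : k →+* R) {D : List (P × P)} (hlt : ∀ q ∈ D, q.1 < q.2)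
    (hD : WeightZero k D)
    (h : ∀ l : List (P × P), l.Nodup → l ≠ [] → (∀ q ∈ l, q.1 < q.2) → WeightZero k l → l.Perm D) :
    d R (glPoset R P) (wedge R D) = 0 := by
  have hspan : d R (glPoset R P) (wedge R D) ∈
      sublistSpan R (fun q : P × P => entry R q.1 q.2) (ltPairs P) := by
    refine mem_sublistSpan_of_contr_eq_zero _ (fun q hq => (mem_ltPairs.1 hq).le) fun q hq => ?_
    by_cases hq' : q.1 ≤ q.2
    · obtain ⟨v, w⟩ := q
      obtain rfl : v = w := hq'.eq_or_lt.resolve_right fun h => hq (mem_ltPairs.2 h)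
      rw [contr_d, lieDer_wedge_of_weightZero ρ hD,
        contr_wedge_of_notMem fun h => lt_irrefl _ (hlt _ h), map_zero, sub_zero]
    · rw [matrixUnit_eq_zero hq', contr_zero_left]
  have hspan' := weightFilter_mem_span ρ _ hspan
  rw [weightFilter, filterOp_d, ← weightFilter, weightFilter_wedge_of_weightZero ρ _ hD] at hspan'
  have hle : Submodule.span R {w | ∃ l : List (P × P), l.Sublist (ltPairs P) ∧ WeightZero k l ∧
      w = wedge R l} ≤ LinearMap.ker (component R (glPoset R P) (D.length + 1)) := by
    rw [Submodule.span_le]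
    rintro _ ⟨l, hl, hw, rfl⟩
    refine (isHomogeneous_wedge l).component_of_ne ?_
    by_cases hl0 : l = []
    · rw [hl0, List.length_nil]
      omega
    · rw [(h l (hl.nodup nodup_ltPairs) hl0 (fun q hq => mem_ltPairs.1 (hl.subset hq)) hw).length_eq]
      omega
  rw [← (isHomogeneous_wedge D).d.component_self]
  exact hle hspan'

/-- If up to order there is exactly one nonempty balanced set of strict relations, and it has odd
cardinality, then the cohomology is generated by the diagonal coordinates and by the exterior
product of the coordinates at this set. -/
theorem exists_algEquiv_of_forall_perm (ρ : k →+* R) {D : List (P × P)} (hne : D ≠ [])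
    (hnodup : D.Nodup) (hlt : ∀ q ∈ D, q.1 < q.2) (hodd : Odd D.length) (hD : WeightZero k D)
    (h : ∀ l : List (P × P), l.Nodup → l ≠ [] → (∀ q ∈ l, q.1 < q.2) → WeightZero k l → l.Perm D) :
    ∃ φ : Ext R (P ⊕ Unit) ≃ₐ[R] Cohomology R (glPoset R P),
      (∀ n, (extDegree R (Sum.elim (fun _ : P => 1) (fun _ : Unit => D.length)) n).map
          φ.toLinearMap = cohomologyDegree R (glPoset R P) n) ∧
      (∀ i, Represents (entry R i i) (φ (gen R (Sum.inl i)))) ∧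
      Represents (wedge R D) (φ (gen R (Sum.inr ()))) := by
  let b : P ⊕ Unit → List (P × P) := Sum.elim (fun v => [(v, v)]) fun _ => D
  have hdiag : ∀ v, (v, v) ∉ D := fun v hv => lt_irrefl _ (hlt _ hv)
  obtain ⟨φ, h1, h2⟩ := exists_cohomology_algEquiv_of_blocks (R := R) ρ b
    (by rintro (v | _) <;> simp [b, hne])
    (by rintro (v | _) <;> simp [b, hnodup])
    (by
      rintro (v | _) q hq
      · rw [List.mem_singleton.1 hq]
      · exact (hlt q hq).le)
    (by
      rintro (v | _) (w | _) hvw q hq hq'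
      · rw [List.mem_singleton.1 hq] at hq'
        exact hvw (congrArg Sum.inl (congrArg Prod.fst (List.mem_singleton.1 hq')))
      · rw [List.mem_singleton.1 hq] at hq'
        exact hdiag v hq'
      · rw [List.mem_singleton.1 hq'] at hq
        exact hdiag w hq
      · exact hvw rfl)
    (by
      rintro (v | _)
      · exact odd_one
      · exact hodd)
    (by
      rintro (v | _)
      · exact weightZero_map_diag [v]
      · exact hD)
    (by
      rintro (v | _)
      · exact (congrArg _ (wedge_singleton (v, v))).trans (d_entry_self v)
      · exact d_wedge_eq_zero ρ hlt hD h)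
    (lePairs P) (fun q => mem_lePairs)
    (fun l hl hw => by
      obtain ⟨s, m, rfl, hm1, hm2, hm3⟩ := exists_eq_diag_append hl hw
      have hs : wedge R (s.map fun v => (v, v)) =
          ((s.map Sum.inl).map fun i => wedge R (b i)).prod := by
        rw [wedge_map_diag, List.map_map]
        rfl
      rw [wedge_append, hs]
      by_cases hm : m = []
      · rw [hm, wedge_nil, mul_one]
        exact Submodule.subset_span ⟨_, rfl⟩
      · have hmem : ((s.map Sum.inl).map fun i => wedge R (b i)).prod * wedge R D ∈
            Submodule.span R (Set.range fun m : List (P ⊕ Unit) =>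
              (m.map fun i => wedge R (b i)).prod) :=
          Submodule.subset_span ⟨s.map Sum.inl ++ [Sum.inr ()], by simp [b]⟩
        rcases prod_perm_eq_or_eq_neg (x := fun q : P × P => entry R q.1 q.2)
            (fun q q' => entry_anticomm _ _ _ _) (h m hm1 hm hm2 hm3) with hp | hp
        · rw [wedge, hp]
          exact hmem
        · rw [wedge, hp, mul_neg]
          exact neg_mem hmem)
  refine ⟨φ, fun n => ?_, fun i => ?_, h2 (Sum.inr ())⟩
  · rw [← h1 n]
    congr 2
    funext i
    rcases i with v | _ <;> rfl
  · have := h2 (Sum.inl i)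
    rwa [show b (Sum.inl i) = [(i, i)] from rfl, wedge_singleton] at this

theorem wedge_diamond (a b : P) (t : List P) : wedge R (diamond a b t) =
    entry R a b * (t.map fun x => entry R a x * entry R x b).prod := by
  rw [diamond, wedge_cons, wedge_flatMap]
  simp only [wedge_cons, wedge_nil, mul_one]

/-- The exterior product over the diamond does not depend on the order of the interior vertices. -/
theorem wedge_diamond_perm (a b : P) {t t' : List P} (h : t.Perm t') :
    wedge R (diamond a b t) = wedge R (diamond a b t') := by
  rw [wedge_diamond, wedge_diamond]
  congr 1
  refine (h.map _).prod_eq' ?_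
  have h2 : ∀ x : P, entry R a x * entry R x b = wedge R [(a, x), (x, b)] := fun x => by
    simp only [wedge_cons, wedge_nil, mul_one]
  refine List.pairwise_map.2 (List.pairwise_of_forall fun x y => ?_)
  -- The factors have even degree, so they commute.
  rw [Commute, SemiconjBy, h2, h2, wedge_mul_wedge]
  change (-1 : R) ^ 4 • _ = _
  rw [Even.neg_one_pow ⟨2, rfl⟩, one_smul]

end Assembly

end Chevalley

theorem theorem5 (R : Type*) [CommRing R] (P : Type*) [Fintype P] [DecidableEq P]
    [PartialOrder P] :
    (((∃ f : ℚ →+* R, Function.Injective f) ∨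
        ∃ p : ℕ, p.Prime ∧ Fintype.card P ≤ p ∧ ∃ f : ZMod p →+* R, Function.Injective f) →
      ∃ φ : Chevalley.Ext R P ≃ₐ[R] Chevalley.Cohomology R (Chevalley.glPoset R P),
        (∀ k, (Chevalley.extDegree R (fun _ : P => 1) k).map φ.toLinearMap =
          Chevalley.cohomologyDegree R (Chevalley.glPoset R P) k) ∧
        ∀ i, Chevalley.Represents (Chevalley.entry R i i) (φ (Chevalley.gen R i))) ∧
    ∀ p : ℕ, p.Prime → p + 1 = Fintype.card P → (∃ f : ZMod p →+* R, Function.Injective f) →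
      (∀ a b : P, IsBot a → IsTop b →
        ∃ φ : Chevalley.Ext R (P ⊕ Unit) ≃ₐ[R] Chevalley.Cohomology R (Chevalley.glPoset R P),
          (∀ k, (Chevalley.extDegree R
              (Sum.elim (fun _ : P => 1) (fun _ : Unit => 2 * p - 1)) k).map φ.toLinearMap =
            Chevalley.cohomologyDegree R (Chevalley.glPoset R P) k) ∧
          (∀ i, Chevalley.Represents (Chevalley.entry R i i) (φ (Chevalley.gen R (Sum.inl i)))) ∧
          ∀ l : List P, l.Nodup → (∀ x, x ∈ l ↔ x ≠ a ∧ x ≠ b) →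
            Chevalley.Represents
              (Chevalley.entry R a b *
                (l.map fun x => Chevalley.entry R a x * Chevalley.entry R x b).prod)
              (φ (Chevalley.gen R (Sum.inr ())))) ∧
      ((¬ ∃ a b : P, IsBot a ∧ IsTop b) →
        ∃ φ : Chevalley.Ext R P ≃ₐ[R] Chevalley.Cohomology R (Chevalley.glPoset R P),
          (∀ k, (Chevalley.extDegree R (fun _ : P => 1) k).map φ.toLinearMap =
            Chevalley.cohomologyDegree R (Chevalley.glPoset R P) k) ∧
          ∀ i, Chevalley.Represents (Chevalley.entry R i i) (φ (Chevalley.gen R i))) := by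
  have hzmod : ∀ p m : ℕ, 0 < m → m < p → (m : ZMod p) ≠ 0 := fun p m h0 hm h =>
    (Nat.le_of_dvd h0 ((ZMod.natCast_eq_zero_iff m p).1 h)).not_gt hm
  refine ⟨?_, fun p hp hcard ⟨ρ, _⟩ => ⟨fun a b ha hb => ?_, fun hab => ?_⟩⟩
  · rintro (⟨ρ, -⟩ | ⟨p, hp, hcard, ρ, -⟩)
    · exact Chevalley.exists_algEquiv_of_forall_eq_nil ρ fun l hl hlt hw =>
        Chevalley.eq_nil_of_weightZero (fun m h0 _ => Nat.cast_ne_zero.2 h0.ne') hl hlt hw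
    · have := Fact.mk hp
      exact Chevalley.exists_algEquiv_of_forall_eq_nil ρ fun l hl hlt hw =>
        Chevalley.eq_nil_of_weightZero (fun m h0 hm => hzmod p m h0 (by omega)) hl hlt hw
  · have := Fact.mk hp
    have hp2 := hp.two_le
    have hk : ∀ m : ℕ, 0 < m → m + 1 < Fintype.card P → (m : ZMod p) ≠ 0 :=
      fun m h0 hm => hzmod p m h0 (by omega)
    have hab : a ≠ b := by
      rintro rfl
      have : Fintype.card P ≤ 1 := Fintype.card_le_one_iff.2 fun x y =>
        (le_antisymm (hb x) (ha x)).trans (le_antisymm (ha y) (hb y))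
      omega
    let T : Finset P := (Finset.univ.erase a).erase b
    have hT : T.card + 1 = p := by
      have h1 := Finset.card_erase_add_one (Finset.mem_univ a)
      have h2 := Finset.card_erase_add_one
        (Finset.mem_erase.2 ⟨Ne.symm hab, Finset.mem_univ b⟩ : b ∈ Finset.univ.erase a)
      rw [Finset.card_univ] at h1
      change T.card + 1 = _ at h2
      omega
    have hmem : ∀ x, x ∈ T.toList ↔ x ≠ a ∧ x ≠ b := fun x => by simp [T, and_comm]
    have hta : a ∉ T.toList := fun h => ((hmem a).1 h).1 rfl
    have htb : b ∉ T.toList := fun h => ((hmem b).1 h).2 rfl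
    have hlen : (Chevalley.diamond a b T.toList).length = 2 * p - 1 := by
      rw [Chevalley.length_diamond, Finset.length_toList]
      omega
    -- The weights are `p` at `a`, `-p` at `b`, and `0` elsewhere.
    have hD : Chevalley.WeightZero (ZMod p) (Chevalley.diamond a b T.toList) := fun v => by
      have h1 : ((T.toList.length : ℤ) + 1) = (p : ℤ) := by
        rw [Finset.length_toList, ← hT, Nat.cast_add, Nat.cast_one]
      rw [Chevalley.weight_diamond, h1, Int.cast_mul, Int.cast_natCast, ZMod.natCast_self,
        zero_mul]
    obtain ⟨φ, h1, h2, h3⟩ := Chevalley.exists_algEquiv_of_forall_perm ρ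
      (D := Chevalley.diamond a b T.toList) (List.cons_ne_nil _ _)
      (Chevalley.nodup_diamond (Finset.nodup_toList T) hta htb)
      (fun q hq => by
        rcases Chevalley.mem_diamond.1 hq with rfl | ⟨x, hx, rfl | rfl⟩
        · exact lt_of_le_of_ne (ha b) hab
        · exact lt_of_le_of_ne (ha x) (Ne.symm ((hmem x).1 hx).1)
        · exact lt_of_le_of_ne (hb x) ((hmem x).1 hx).2)
      (by rw [hlen]; exact ⟨p - 1, by omega⟩) hD
      (fun l hl hne hlt hw => Chevalley.perm_diamond_of_weightZero hk ha hb hab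
        (Finset.nodup_toList T) hmem hD hl hne hlt hw)
    refine ⟨φ, fun n => ?_, h2, fun l hl hl' => ?_⟩
    · rw [← h1 n, hlen]
    · have hperm : l.Perm T.toList :=
        (List.perm_ext_iff_of_nodup hl (Finset.nodup_toList T)).2 fun x =>
          (hl' x).trans (hmem x).symm
      rw [← Chevalley.wedge_diamond, Chevalley.wedge_diamond_perm a b hperm]
      exact h3
  · have := Fact.mk hp
    refine Chevalley.exists_algEquiv_of_forall_eq_nil ρ fun l hl hlt hw => ?_
    by_contra hne
    obtain ⟨a, b, ha, hb⟩ := Chevalley.exists_bot_top_of_weightZero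
      (fun m h0 hm => hzmod p m h0 (by omega)) hl hne hlt hw
    refine hab ⟨a, b, fun x => ?_, fun x => ?_⟩
    · by_cases h : x = a
      · exact h.ge
      · exact (hlt _ (ha x h)).le
    · by_cases h : x = b
      · exact h.le
      · exact (hlt _ (hb x h)).le
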